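/- Let $2\le k\le n$ be integers and let $\Pi=\Pi_{n,k}$ be the lattice, ordered by refinement, of all partitions of $\{1,\dots,n\}$ each of whose blocks has either exactly one element (a trivial block) or at least $k$ elements (a non-trivial block). Its least element $0$ is the partition into singletons and its greatest element $1$ is the partition with one block. To $A\in\Pi$ corresponds the subspace of $\mathbf C^n$ that is the sum of the subspaces $V(\omega)=\{x:\sum_{i\in\omega}x_i=0,\ x_j=0\text{ for }j\notin\omega\}$ over all $k$-element subsets $\omega$ of blocks of $A$; $A\cap B$ denotes the intersection of the subspaces corresponding to $A$ and $B$. A one-block partition is an element of $\Pi$ with exactly one non-trivial block. For one-block partitions $A,B$ with non-trivial blocks $b_A,b_B$, the conditions $A\vee B=1$ and $A\cap B=0$ together mean that $b_A\cup b_B=\{1,\dots,n\}$ and $|b_A\cap b_B|=1$. For $A,B\in\Pi$ with $A\vee B=1$ let $\Pi_{A,B}$ be the subposet of $\Pi$ of all joins of sets of atoms of $\Pi$ each of which lies below $A$ or below $B$. For a commutative ring $R$ and an integer $p$, let $\tilde H_p(\Pi)$ and $\tilde H_p(\Pi_{A,B})$ be the reduced homology groups with coefficients in $R$ of the complexes of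 flags (finite chains) of the posets $\Pi\setminus\{0,1\}$ and $\Pi_{A,B}\setminus\{0,1\}$. Let $$\xi_p:\bigoplus_{\{A,B\}}\tilde H_p(\Pi_{A,B})\to\tilde H_p(\Pi)$$ be the homomorphism induced by the embeddings $\Pi_{A,B}\subseteq\Pi$, where $\{A,B\}$ runs over all sets of one-block partitions $A,B\in\Pi$ with $A\vee B=1$ and $A\cap B=0$. Then, for every $R$ and every integer $p<n-k-1$, the homomorphism $\xi_p$ is surjective. -/

import Mathlib

/-! ### Reduced homology of a poset, computed from its complex of flags -/

namespace PosetHomology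

/-- A flag of a poset `P`: a finite chain, possibly empty. A flag with `p + 1` elements is a
`p`-simplex of the flag complex; the empty flag is the simplex of dimension `-1` that gives the
augmentation. -/
def FinFlag (P : Type*) [PartialOrder P] : Type _ :=
  {s : Finset P // IsChain (· ≤ ·) (s : Set P)}

variable {P Q : Type*} [PartialOrder P] [PartialOrder Q]

open Classical in
/-- Remove an element from a flag. -/
noncomputable def FinFlag.erase (s : FinFlag P) (a : P) : FinFlag P :=
  ⟨s.1.erase a, s.2.mono (by simp)⟩

/-- The image of a flag under an order embedding. -/
def FinFlag.map (f : P ↪o Q) (s : FinFlag P) : FinFlag Q :=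
  ⟨s.1.map f.toEmbedding, by
    rw [Finset.coe_map]
    rintro _ ⟨a, ha, rfl⟩ _ ⟨b, hb, rfl⟩ _
    exact (s.2.total ha hb).imp (fun h => f.monotone h) fun h => f.monotone h⟩

variable (R : Type*) [CommRing R]

open Classical in
/-- The boundary operator on all flag chains:
`∂ (a₀ < ⋯ < aₚ) = ∑ i, (-1) ^ i • (a₀ < ⋯ < aᵢ₋₁ < aᵢ₊₁ < ⋯ < aₚ)`. -/
noncomputable def boundary (P : Type*) [PartialOrder P] :
    (FinFlag P →₀ R) →ₗ[R] (FinFlag P →₀ R) :=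
  Finsupp.linearCombination R fun s : FinFlag P =>
    ∑ a ∈ s.1, Finsupp.single (s.erase a) ((-1 : R) ^ (s.1.filter (· < a)).card)

/-- The chains of dimension `p`: combinations of flags with `p + 1` elements. -/
noncomputable def chains (P : Type*) [PartialOrder P] (p : ℤ) : Submodule R (FinFlag P →₀ R) :=
  Finsupp.supported R R {s : FinFlag P | (s.1.card : ℤ) = p + 1}

/-- The reduced cycles of dimension `p`. -/
noncomputable def cycles (P : Type*) [PartialOrder P] (p : ℤ) : Submodule R (FinFlag P →₀ R) :=
  chains R P p ⊓ LinearMap.ker (boundary R P)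

/-- The boundaries of dimension `p`. -/
noncomputable def boundaries (P : Type*) [PartialOrder P] (p : ℤ) :
    Submodule R (FinFlag P →₀ R) :=
  (chains R P (p + 1)).map (boundary R P)

set_option maxSynthPendingDepth 10 in
/-- The reduced homology `H̃ₚ(P; R)` of the poset `P`: reduced cycles modulo boundaries. -/
def RedHomology (P : Type*) [PartialOrder P] (p : ℤ) : Type _ :=
  cycles R P p ⧸ (boundaries R P p).submoduleOf (cycles R P p)

set_option maxSynthPendingDepth 10 in
noncomputable instance (P : Type*) [PartialOrder P] (p : ℤ) : AddCommGroup (RedHomology R P p) :=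
  inferInstanceAs (AddCommGroup (cycles R P p ⧸ (boundaries R P p).submoduleOf (cycles R P p)))

set_option maxSynthPendingDepth 10 in
noncomputable instance (P : Type*) [PartialOrder P] (p : ℤ) : Module R (RedHomology R P p) :=
  inferInstanceAs (Module R (cycles R P p ⧸ (boundaries R P p).submoduleOf (cycles R P p)))

/-- The map on flag chains induced by an order embedding. -/
noncomputable def chainMap (f : P ↪o Q) : (FinFlag P →₀ R) →ₗ[R] (FinFlag Q →₀ R) :=
  Finsupp.lmapDomain R R (FinFlag.map f)

theorem chainMap_boundary (f : P ↪o Q) (x : FinFlag P →₀ R) :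
    chainMap R f (boundary R P x) = boundary R Q (chainMap R f x) := by
  classical
  suffices h : chainMap R f ∘ₗ boundary R P = boundary R Q ∘ₗ chainMap R f from
    LinearMap.congr_fun h x
  refine Finsupp.lhom_ext' fun s => LinearMap.ext_ring ?_
  simp only [chainMap, boundary, LinearMap.comp_apply, Finsupp.lsingle_apply,
    Finsupp.lmapDomain_apply, Finsupp.mapDomain_single, Finsupp.linearCombination_single,
    one_smul, Finsupp.mapDomain_finsetSum]
  rw [show (FinFlag.map f s).1 = s.1.map f.toEmbedding from rfl, Finset.sum_map]
  refine Finset.sum_congr rfl fun a _ => ?_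
  congr 1
  · apply Subtype.ext
    simp only [FinFlag.map, FinFlag.erase]
    exact Finset.map_erase f.toEmbedding s.1 a
  · congr 1
    rw [Finset.filter_map, Finset.card_map]
    congr 1
    ext b
    simp

theorem chainMap_mem_chains (f : P ↪o Q) (p : ℤ) {x : FinFlag P →₀ R}
    (hx : x ∈ chains R P p) : chainMap R f x ∈ chains R Q p := by
  classical
  intro t ht
  obtain ⟨s, hs, rfl⟩ := Finset.mem_image.1 (Finsupp.mapDomain_support ht)
  have : (s.1.card : ℤ) = p + 1 := hx hs
  change ((s.1.map f.toEmbedding).card : ℤ) = p + 1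
  rwa [Finset.card_map]

/-- The map on reduced cycles induced by an order embedding. -/
noncomputable def cyclesMap (f : P ↪o Q) (p : ℤ) : cycles R P p →ₗ[R] cycles R Q p :=
  (chainMap R f).restrict fun x hx =>
    ⟨chainMap_mem_chains R f p hx.1, by
      change boundary R Q (chainMap R f x) = 0
      rw [← chainMap_boundary, LinearMap.mem_ker.1 hx.2, map_zero]⟩

set_option maxSynthPendingDepth 10 in
/-- The map on reduced homology induced by an order embedding. -/
noncomputable def redHomologyMap (f : P ↪o Q) (p : ℤ) :
    RedHomology R P p →ₗ[R] RedHomology R Q p :=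
  Submodule.mapQ ((boundaries R P p).submoduleOf (cycles R P p))
    ((boundaries R Q p).submoduleOf (cycles R Q p)) (cyclesMap R f p) (by
      rintro x ⟨y, hy, hyx⟩
      refine ⟨chainMap R f y, chainMap_mem_chains R f _ hy, ?_⟩
      rw [← chainMap_boundary, hyx]
      rfl)

end PosetHomology

/-! ### The lattices of partitions with forbidden small block sizes -/

namespace KEqual

open PosetHomology

/-- The partitions of an `n`-element set, each of whose blocks has exactly one element or at
least `k` elements. Partitions are equivalence relations, ordered by refinement: `r ≤ s` means
that every block of `r` lies in a block of `s`. -/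
def PiLattice (n k : ℕ) : Type :=
  {r : Setoid (Fin n) // ∀ b ∈ r.classes, b.ncard = 1 ∨ k ≤ b.ncard}

variable {n k : ℕ}

instance : PartialOrder (PiLattice n k) :=
  inferInstanceAs (PartialOrder {r : Setoid (Fin n) // ∀ b ∈ r.classes, b.ncard = 1 ∨ k ≤ b.ncard})

/-- The family is closed under joins of partitions. -/
theorem sSup_blocks (S : Set (PiLattice n k)) :
    ∀ b ∈ (sSup (Subtype.val '' S) : Setoid (Fin n)).classes, b.ncard = 1 ∨ k ≤ b.ncard := by
  rintro b ⟨x, rfl⟩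
  set j : Setoid (Fin n) := sSup (Subtype.val '' S) with hj
  by_cases h : ∃ r ∈ S, ∃ y, r.1 y x ∧ y ≠ x
  · obtain ⟨r, hr, y, hyx, hne⟩ := h
    right
    have hle : r.1 ≤ j := le_sSup ⟨r, hr, rfl⟩
    have hsub : {z | r.1 z x} ⊆ {z | j z x} := fun z hz => hle hz
    rcases r.2 _ ⟨x, rfl⟩ with h1 | hk
    · obtain ⟨w, hw⟩ := Set.ncard_eq_one.1 h1
      have hx : x ∈ {z | r.1 z x} := r.1.refl x
      have hy : y ∈ {z | r.1 z x} := hyx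
      rw [hw] at hx hy
      exact absurd (hy.trans hx.symm) hne
    · exact hk.trans (Set.ncard_le_ncard hsub (Set.toFinite _))
  · left
    push Not at h
    let t : Setoid (Fin n) :=
      ⟨fun y z => (y = x ↔ z = x), fun _ => Iff.rfl, fun h => h.symm, fun h h' => h.trans h'⟩
    have hle : j ≤ t := by
      refine sSup_le ?_
      rintro _ ⟨r, hr, rfl⟩ y z hyz
      change y = x ↔ z = x
      constructor
      · rintro rfl
        exact h r hr z (r.1.symm hyz)
      · rintro rfl
        exact h r hr y hyz
    refine Set.ncard_eq_one.2 ⟨x, Set.ext fun y => ⟨fun hy => ?_, ?_⟩⟩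
    · have h2 : y = x ↔ x = x := hle hy
      exact h2.2 rfl
    · rintro rfl
      exact j.refl _

/-- Joins in `PiLattice n k` are joins of partitions. -/
instance : SupSet (PiLattice n k) := ⟨fun S => ⟨sSup (Subtype.val '' S), sSup_blocks S⟩⟩

/-- The lattice structure for the refinement order. For `2 ≤ k ≤ n` its least element is the
partition into one-element sets and its greatest element is the partition with a single block. -/
instance : CompleteLattice (PiLattice n k) :=
  completeLatticeOfSup (PiLattice n k) fun S =>
    ⟨fun r hr => (le_sSup ⟨r, hr, rfl⟩ : r.1 ≤ sSup (Subtype.val '' S)), fun r hr =>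
      (sSup_le (by rintro _ ⟨s, hs, rfl⟩; exact hr hs) : sSup (Subtype.val '' S) ≤ r.1)⟩

/-- One-block partitions: those with exactly one non-trivial block. -/
def IsOneBlock (A : PiLattice n k) : Prop :=
  ∃! b : Set (Fin n), b ∈ A.1.classes ∧ b.ncard ≠ 1

/-- `V(ω) = {x ∈ ℂⁿ : ∑_{i ∈ ω} x_i = 0 and x_j = 0 for j ∉ ω}`. -/
def blockSubspace (ω : Finset (Fin n)) : Submodule ℂ (Fin n → ℂ) where
  carrier := {x | ∑ i ∈ ω, x i = 0 ∧ ∀ j ∉ ω, x j = 0}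
  zero_mem' := by simp
  add_mem' := by
    rintro x y ⟨hx, hx'⟩ ⟨hy, hy'⟩
    exact ⟨by simp [Finset.sum_add_distrib, hx, hy], fun j hj => by simp [hx' j hj, hy' j hj]⟩
  smul_mem' := by
    rintro c x ⟨hx, hx'⟩
    exact ⟨by simp [← Finset.mul_sum, hx], fun j hj => by simp [hx' j hj]⟩

/-- The subspace of `ℂⁿ` that corresponds to the partition `A`: the sum of all `V(ω)` where `ω`
is a `k`-element subset of a block of `A`. -/
noncomputable def subspace (A : PiLattice n k) : Submodule ℂ (Fin n → ℂ) :=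
  ⨆ ω ∈ {ω : Finset (Fin n) | ω.card = k ∧ ∃ b ∈ A.1.classes, (ω : Set (Fin n)) ⊆ b},
    blockSubspace ω

/-- The proper part `Π ∖ {0, 1}` of `Π = PiLattice n k`; the homology of the lattice is that of
its proper part. -/
abbrev ProperPart (n k : ℕ) : Type := {C : PiLattice n k // C ≠ ⊥ ∧ C ≠ ⊤}

/-- For `s = {A, B}`: the joins of all sets of atoms, each of which lies below `A` or below `B`. -/
def joinsOfAtoms (s : Set (PiLattice n k)) : Set (PiLattice n k) :=
  {C | ∃ τ : Set (PiLattice n k), (∀ a ∈ τ, IsAtom a ∧ ∃ A ∈ s, a ≤ A) ∧ C = sSup τ}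

/-- The poset `Π_{A,B}` for `s = {A, B}` with `A ∨ B = 1`: the joins of atoms below `A` or `B`,
without `0` and `1`, as a subposet of the proper part of `Π`. -/
def pairPoset (s : Set (PiLattice n k)) : Set (ProperPart n k) :=
  {C | C.1 ∈ joinsOfAtoms s}

/-- The index set of the direct sum: the sets `{A, B}` of one-block partitions with `A ∨ B = 1`
and `A ∩ B = 0`, the latter as subspaces of `ℂⁿ`. -/
abbrev Pairs (n k : ℕ) : Type :=
  {s : Set (PiLattice n k) // ∃ A B : PiLattice n k, s = {A, B} ∧ IsOneBlock A ∧ IsOneBlock B ∧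
    A ⊔ B = ⊤ ∧ subspace A ⊓ subspace B = ⊥}

open Classical in
/-- The homomorphism `ξₚ : ⨁_{A,B} H̃ₚ(Π_{A,B}; R) → H̃ₚ(Π; R)` induced by the embeddings. -/
noncomputable def xi (R : Type*) [CommRing R] (n k : ℕ) (p : ℤ) :
    (DirectSum (Pairs n k) fun s => RedHomology R (pairPoset s.1) p) →ₗ[R]
      RedHomology R (ProperPart n k) p :=
  DirectSum.toModule R (Pairs n k) _ fun s =>
    redHomologyMap R (OrderEmbedding.subtype (· ∈ pairPoset s.1)) p

end KEqual

/-! Say that a partition fixes or moves a point according as its block is trivial or not, and count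
flags by their number of elements `q = p + 1`. The claim is proved for all intervals `(d, ⊤)`:
modulo boundaries, their cycles come from the posets `Π_s` of pairs `s`.

Let `d` fix `i`. The elements of `(d, ⊤)` above some `z > d` that fixes `i` form an acyclic set `Q`:
each `x` has a greatest element `m x` below it that fixes `i`, and `x ≥ m x ≤ m ⊤` contracts `Q`
(`flagCycles_le_flagBoundaries`). Outside `Q` there are only covers `e` of `d` that move `i`, each
with link `(e, ⊤)`. A cycle through `e` is thus governed by a cycle of `(e, ⊤)` one dimension lower,
which by induction comes from posets `Π_s`. If only one member of `s` moves `i`, the same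
contraction works inside `Π_s`, so a link cycle in `Π_s` also bounds there without `e`; cone minus
filling is then a cycle in `Π_s` (`flagCycles_le_of_minimal`, `flagCycles_Ioo_le_spannedCycles`).

Above `⊥` the relevant covers are atoms moving `i`, with `n - k` fixed points. A second point `j` of
the atom's block is kept as the common point of all pairs used. Each later cover either attaches a
fixed point to a non-trivial block, which costs one fixed point and one dimension, or creates a
non-trivial block apart from that of `j`. In the absence of a second block the bound on `q` persists
and the dimensions run out before the fixed points. A second block, once present, survives until no
point is fixed; then the block `T` of `j` and `Tᶜ ∪ {j}` give one pair whose poset contains all of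
`(d, ⊤)` (`exists_pair_of_forall_moves`, `flagCycles_Ioo_le_of_moves`). -/

namespace PosetHomology

/-! ### Insertion of an element as a chain homotopy. -/

variable {X : Type*} [PartialOrder X] (R : Type*) [CommRing R]

/-- A flag is compatible with `y` if adding `y` to it gives a flag. -/
def FinFlag.Compat (s : FinFlag X) (y : X) : Prop := ∀ x ∈ s.1, x ≤ y ∨ y ≤ x

open Classical in
/-- Add a compatible element to a flag. -/
noncomputable def FinFlag.insert (s : FinFlag X) (y : X) (h : s.Compat y) : FinFlag X :=
  ⟨Insert.insert y s.1, by
    rw [Finset.coe_insert]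
    exact s.2.insert fun b hb _ => (h b hb).symm⟩

theorem FinFlag.mem_erase {s : FinFlag X} {a x : X} : x ∈ (s.erase a).1 ↔ x ≠ a ∧ x ∈ s.1 := by
  classical exact Finset.mem_erase

theorem FinFlag.mem_insert {s : FinFlag X} {y x : X} {h : s.Compat y} :
    x ∈ (s.insert y h).1 ↔ x = y ∨ x ∈ s.1 := by
  classical exact Finset.mem_insert

theorem FinFlag.Compat.erase {s : FinFlag X} {y : X} (h : s.Compat y) (a : X) :
    (s.erase a).Compat y := fun x hx => h x (FinFlag.mem_erase.1 hx).2

open Classical in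
/-- The signed insertion of `y` into a flag; it is zero if `y` already belongs to the flag or
is not compatible with it. -/
noncomputable def insertFlag (y : X) (s : FinFlag X) : FinFlag X →₀ R :=
  if h : s.Compat y ∧ y ∉ s.1 then
    Finsupp.single (s.insert y h.1) ((-1 : R) ^ (s.1.filter (· < y)).card)
  else 0

/-- The signed insertion of `y` into flag chains. -/
noncomputable def insertChain (y : X) : (FinFlag X →₀ R) →ₗ[R] (FinFlag X →₀ R) :=
  Finsupp.linearCombination R (insertFlag R y)

theorem insertChain_single (y : X) (s : FinFlag X) (c : R) :
    insertChain R y (Finsupp.single s c) = c • insertFlag R y s := by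
  simp [insertChain]

theorem insertFlag_of_mem {y : X} {s : FinFlag X} (h : y ∈ s.1) : insertFlag R y s = 0 := by
  simp [insertFlag, h]

open Classical in
theorem insertFlag_of_notMem {y : X} {s : FinFlag X} (hc : s.Compat y) (h : y ∉ s.1) :
    insertFlag R y s =
      Finsupp.single (s.insert y hc) ((-1 : R) ^ (s.1.filter (· < y)).card) := by
  rw [insertFlag, dif_pos ⟨hc, h⟩]

open Classical in
theorem boundary_single (s : FinFlag X) :
    boundary R X (Finsupp.single s 1) =
      ∑ a ∈ s.1, Finsupp.single (s.erase a) ((-1 : R) ^ (s.1.filter (· < a)).card) := by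
  simp [boundary]

-- Every face other than the one omitting `y` still contains `y` and is killed by the insertion; the
-- two equal signs on the remaining face multiply to 1.
open Classical in
theorem insertFlag_boundary_of_mem {y : X} {s : FinFlag X} (hc : s.Compat y) (h : y ∈ s.1) :
    insertChain R y (boundary R X (Finsupp.single s 1)) = Finsupp.single s 1 := by
  rw [boundary_single, map_sum, Finset.sum_eq_single_of_mem y h]
  · rw [insertChain_single, insertFlag_of_notMem R (hc.erase y) (by simp [FinFlag.erase]),
      Finsupp.smul_single, smul_eq_mul]
    have h1 : (s.erase y).insert y (hc.erase y) = s :=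
      Subtype.ext (Finset.insert_erase h)
    have h2 : (s.erase y).1.filter (· < y) = s.1.filter (· < y) := by
      ext b
      simp only [FinFlag.erase, Finset.mem_filter, Finset.mem_erase]
      exact ⟨fun h => ⟨h.1.2, h.2⟩, fun h => ⟨⟨h.2.ne, h.1⟩, h.2⟩⟩
    rw [h1, h2, ← mul_pow]
    simp
  · intro a ha hay
    rw [insertChain_single, insertFlag_of_mem, smul_zero]
    simp [FinFlag.erase, h, hay.symm]

open Classical in
theorem boundary_insertFlag_of_notMem {y : X} {s : FinFlag X} (hc : s.Compat y) (h : y ∉ s.1) :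
    boundary R X (insertFlag R y s) + insertChain R y (boundary R X (Finsupp.single s 1)) =
      Finsupp.single s 1 := by
  have h0 : insertFlag R y s = ((-1 : R) ^ (s.1.filter (· < y)).card) •
      Finsupp.single (s.insert y hc) 1 := by
    rw [insertFlag_of_notMem R hc h, Finsupp.smul_single, smul_eq_mul, mul_one]
  rw [h0, map_smul, boundary_single, boundary_single, map_sum,
    show (s.insert y hc).1 = Insert.insert y s.1 from rfl, Finset.sum_insert h, smul_add, add_assoc]
  have h1 : (s.insert y hc).erase y = s := Subtype.ext (Finset.erase_insert h)
  have h2 : (Insert.insert y s.1).filter (· < y) = s.1.filter (· < y) := by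
    simp [Finset.filter_insert]
  rw [h1, h2, Finsupp.smul_single, smul_eq_mul, ← mul_pow]
  simp only [neg_mul_neg, one_mul, one_pow]
  rw [add_eq_left, Finset.smul_sum, ← Finset.sum_add_distrib]
  refine Finset.sum_eq_zero fun a ha => ?_
  have hay : a ≠ y := fun e => h (e ▸ ha)
  have hya : y ∉ (s.erase a).1 := fun e => h (Finset.mem_of_mem_erase e)
  have h3 : (s.insert y hc).erase a = (s.erase a).insert y (hc.erase a) :=
    Subtype.ext (Finset.erase_insert_of_ne hay.symm)
  rw [insertChain_single, insertFlag_of_notMem R (hc.erase a) hya, h3, Finsupp.smul_single,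
    Finsupp.smul_single, ← Finsupp.single_add, smul_eq_mul, smul_eq_mul]
  -- The two terms with `a` removed have opposite signs: either `a` counts among the elements below
  -- `y`, or `y` counts among those below `a`, never both.
  refine Eq.trans (congrArg _ ?_) (Finsupp.single_zero _)
  rcases hc a ha with hlt | hlt
  · have hlt : a < y := lt_of_le_of_ne hlt hay
    have e1 : (Insert.insert y s.1).filter (· < a) = s.1.filter (· < a) := by
      rw [Finset.filter_insert, if_neg hlt.not_gt]
    have e2 : (s.1.filter (· < y)).card = ((s.erase a).1.filter (· < y)).card + 1 := by
      rw [show (s.erase a).1 = s.1.erase a from rfl, Finset.filter_erase,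
        Finset.card_erase_add_one]
      simp [ha, hlt]
    rw [e1, e2]
    ring
  · have hlt : y < a := lt_of_le_of_ne hlt hay.symm
    have e1 : ((Insert.insert y s.1).filter (· < a)).card = (s.1.filter (· < a)).card + 1 := by
      rw [Finset.filter_insert, if_pos hlt, Finset.card_insert_of_notMem]
      simp [h]
    have e2 : (s.1.filter (· < y)) = ((s.erase a).1.filter (· < y)) := by
      rw [show (s.erase a).1 = s.1.erase a from rfl, Finset.filter_erase,
        Finset.erase_eq_of_notMem]
      simp [hlt.not_gt]
    rw [e1, e2]
    ring

theorem map_mem_of_support {α M : Type*} [AddCommGroup M] [Module R M] {f : (α →₀ R) →ₗ[R] M}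
    {N : Submodule R M} {z : α →₀ R} (h : ∀ s ∈ z.support, f (Finsupp.single s 1) ∈ N) :
    f z ∈ N := by
  rw [← Finsupp.sum_single z, Finsupp.sum, map_sum]
  refine N.sum_mem fun s hs => ?_
  rw [← mul_one (z s), ← smul_eq_mul, ← Finsupp.smul_single, map_smul]
  exact N.smul_mem _ (h s hs)

/-- Insertion of `y` is a contracting homotopy on the flags compatible with `y`. -/
theorem boundary_insertChain_add {y : X} {z : FinFlag X →₀ R}
    (hz : ∀ s ∈ z.support, s.Compat y) :
    boundary R X (insertChain R y z) + insertChain R y (boundary R X z) = z := by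
  have := map_mem_of_support R (N := ⊥) (z := z) (f := boundary R X ∘ₗ insertChain R y +
    insertChain R y ∘ₗ boundary R X - LinearMap.id) (fun s hs => by
      have hc := hz s hs
      simp only [LinearMap.sub_apply, LinearMap.add_apply, LinearMap.comp_apply,
        LinearMap.id_apply, Submodule.mem_bot, sub_eq_zero, insertChain_single, one_smul]
      by_cases h : y ∈ s.1
      · rw [insertFlag_boundary_of_mem R hc h, insertFlag_of_mem R h, map_zero, zero_add]
      · exact boundary_insertFlag_of_notMem R hc h)
  simpa [sub_eq_zero] using this

/-! ### Chains, cycles and boundaries in a subset, graded by flag size. -/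

/-- The chains of flags with `q` elements, all in `U`. -/
noncomputable def flagChains (U : Set X) (q : ℤ) : Submodule R (FinFlag X →₀ R) :=
  Finsupp.supported R R {s : FinFlag X | (∀ x ∈ s.1, x ∈ U) ∧ (s.1.card : ℤ) = q}

/-- The cycles of flags with `q` elements, all in `U`. -/
noncomputable def flagCycles (U : Set X) (q : ℤ) : Submodule R (FinFlag X →₀ R) :=
  flagChains R U q ⊓ LinearMap.ker (boundary R X)

/-- The boundaries of chains in `U` that consist of flags with `q` elements. -/
noncomputable def flagBoundaries (U : Set X) (q : ℤ) : Submodule R (FinFlag X →₀ R) :=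
  (flagChains R U (q + 1)).map (boundary R X)

variable {R}

theorem mem_flagChains {U : Set X} {q : ℤ} {z : FinFlag X →₀ R} :
    z ∈ flagChains R U q ↔ ∀ s ∈ z.support, (∀ x ∈ s.1, x ∈ U) ∧ (s.1.card : ℤ) = q :=
  Iff.rfl

theorem flagChains_mono {U V : Set X} (h : U ⊆ V) (q : ℤ) : flagChains R U q ≤ flagChains R V q :=
  Finsupp.supported_mono fun _ hs => ⟨fun x hx => h (hs.1 x hx), hs.2⟩

theorem flagCycles_mono {U V : Set X} (h : U ⊆ V) (q : ℤ) : flagCycles R U q ≤ flagCycles R V q :=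
  inf_le_inf_right _ (flagChains_mono h q)

theorem flagBoundaries_mono {U V : Set X} (h : U ⊆ V) (q : ℤ) :
    flagBoundaries R U q ≤ flagBoundaries R V q :=
  Submodule.map_mono (flagChains_mono h _)

theorem boundary_mem_flagChains {U : Set X} {q : ℤ} {z : FinFlag X →₀ R}
    (hz : z ∈ flagChains R U q) : boundary R X z ∈ flagChains R U (q - 1) := by
  classical
  refine map_mem_of_support R fun s hs => ?_
  rw [boundary_single]
  refine Submodule.sum_mem _ fun a ha => Finsupp.single_mem_supported R _ ⟨fun x hx =>
    (mem_flagChains.1 hz s hs).1 x (FinFlag.mem_erase.1 hx).2, ?_⟩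
  rw [← (mem_flagChains.1 hz s hs).2, ← Finset.card_erase_add_one ha]
  simp [FinFlag.erase]

theorem insertChain_mem_flagChains {U : Set X} {q : ℤ} {y : X} (hy : y ∈ U) {z : FinFlag X →₀ R}
    (hz : z ∈ flagChains R U q) : insertChain R y z ∈ flagChains R U (q + 1) := by
  classical
  refine map_mem_of_support R fun s hs => ?_
  rw [insertChain_single, one_smul]
  by_cases h : s.Compat y ∧ y ∉ s.1
  · rw [insertFlag_of_notMem R h.1 h.2]
    refine Finsupp.single_mem_supported R _ ⟨fun x hx => ?_, ?_⟩
    · rcases FinFlag.mem_insert.1 hx with rfl | hx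
      · exact hy
      · exact (mem_flagChains.1 hz s hs).1 x hx
    · rw [← (mem_flagChains.1 hz s hs).2]
      simp [FinFlag.insert, h.2]
  · rw [insertFlag, dif_neg h]
    exact Submodule.zero_mem _

/-- Writing a flag as a cone `y * t`, the homotopy formula gives `∂(y * t) = t - y * ∂t`, hence
`∂∂(y * t) = y * ∂∂t`, which vanishes by induction on the size. -/
theorem boundary_boundary_single (s : FinFlag X) :
    boundary R X (boundary R X (Finsupp.single s 1)) = 0 := by
  classical
  induction hm : s.1.card generalizing s with
  | zero =>
    rw [boundary_single, Finset.card_eq_zero.1 hm]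
    simp
  | succ m ih =>
    obtain ⟨y, hy⟩ : s.1.Nonempty := Finset.card_pos.1 (by omega)
    have hs : ∀ x ∈ s.1, x ≤ y ∨ y ≤ x := fun x hx => s.2.total hx hy
    have hc : (s.erase y).Compat y := FinFlag.Compat.erase hs y
    have hne : y ∉ (s.erase y).1 := fun h => (FinFlag.mem_erase.1 h).1 rfl
    have h1 : (s.erase y).insert y hc = s := Subtype.ext (Finset.insert_erase hy)
    have ih' := ih (s.erase y) (by
      rw [show (s.erase y).1 = s.1.erase y from rfl, Finset.card_erase_of_mem hy, hm]; rfl)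
    have hB : boundary R X (insertFlag R y (s.erase y)) = Finsupp.single (s.erase y) 1 -
        insertChain R y (boundary R X (Finsupp.single (s.erase y) 1)) :=
      eq_sub_of_add_eq (boundary_insertFlag_of_notMem R hc hne)
    have hcomp : ∀ t ∈ (boundary R X (Finsupp.single (s.erase y) (1 : R))).support,
        t.Compat y := fun t ht x hx => by
      have := boundary_mem_flagChains (R := R) (U := {x | x ∈ (s.erase y).1})
        (q := (s.erase y).1.card)
        (z := Finsupp.single (s.erase y) 1) (Finsupp.single_mem_supported R _ ⟨fun x hx => hx, rfl⟩)
      exact hc x ((mem_flagChains.1 this t ht).1 x hx)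
    have key := boundary_insertChain_add R hcomp
    rw [ih', map_zero, add_zero] at key
    have h2 : boundary R X (boundary R X (insertFlag R y (s.erase y))) = 0 := by
      rw [hB, map_sub, key, sub_self]
    rw [insertFlag_of_notMem R hc hne, h1] at h2
    have h3 : Finsupp.single s (1 : R) = ((-1 : R) ^ ((s.erase y).1.filter (· < y)).card) •
        Finsupp.single s ((-1 : R) ^ ((s.erase y).1.filter (· < y)).card) := by
      rw [Finsupp.smul_single, smul_eq_mul, ← mul_pow]
      simp
    rw [h3, map_smul, map_smul, h2, smul_zero]

theorem boundary_boundary (z : FinFlag X →₀ R) : boundary R X (boundary R X z) = 0 := by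
  have := map_mem_of_support R (N := ⊥) (z := z) (f := boundary R X ∘ₗ boundary R X)
    fun s _ => boundary_boundary_single s
  exact this

theorem flagBoundaries_le_ker (U : Set X) (q : ℤ) :
    flagBoundaries R U q ≤ LinearMap.ker (boundary R X) := by
  rintro _ ⟨w, -, rfl⟩
  exact boundary_boundary w

/-! ### Acyclicity criteria and removal of single elements. -/

/-- If all elements of `U` are comparable with the element `a` of `U`, then `U` is acyclic. -/
theorem flagCycles_le_of_cone {U : Set X} {a : X} (ha : a ∈ U) (h : ∀ x ∈ U, x ≤ a ∨ a ≤ x)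
    (q : ℤ) : flagCycles R U q ≤ flagBoundaries R U q := by
  intro z hz
  refine ⟨insertChain R a z, insertChain_mem_flagChains ha hz.1, ?_⟩
  have := boundary_insertChain_add R (y := a) (z := z)
    fun s hs x hx => h x ((mem_flagChains.1 hz.1 s hs).1 x hx)
  rwa [LinearMap.mem_ker.1 hz.2, map_zero, add_zero] at this

open Classical in
theorem filter_mem_flagChains {U : Set X} {q : ℤ} {z : FinFlag X →₀ R}
    (hz : z ∈ flagChains R U q) (x : X) :
    z.filter (fun s => x ∈ s.1) ∈ flagChains R U q := fun s hs =>
  hz (Finsupp.support_filter (fun s : FinFlag X => x ∈ s.1) z ▸ hs |> Finset.mem_of_mem_filter s)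

open Classical in
theorem filter_not_mem_flagChains {U : Set X} {q : ℤ} {z : FinFlag X →₀ R}
    (hz : z ∈ flagChains R U q) (x : X) :
    z.filter (fun s => x ∉ s.1) ∈ flagChains R (U \ {x}) q := by
  rw [mem_flagChains]
  intro s hs
  rw [Finsupp.support_filter, Finset.mem_filter] at hs
  have := mem_flagChains.1 hz s hs.1
  exact ⟨fun w hw => ⟨this.1 w hw, fun e => hs.2 (Set.mem_singleton_iff.1 e ▸ hw)⟩, this.2⟩

open Classical in
/-- The boundary of the part of a cycle formed by the flags through `x` avoids `x`. -/
theorem boundary_filter_mem_flagChains {U : Set X} {q : ℤ} {z : FinFlag X →₀ R}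
    (hz : z ∈ flagCycles R U q) (x : X) :
    boundary R X (z.filter (fun s => x ∈ s.1)) ∈ flagChains R (U \ {x}) (q - 1) := by
  have h := Finsupp.filter_add_filter_not z (fun s : FinFlag X => x ∈ s.1)
  have h' := congrArg (boundary R X) h
  rw [map_add, LinearMap.mem_ker.1 hz.2] at h'
  rw [eq_neg_of_add_eq_zero_left h']
  exact Submodule.neg_mem _ (boundary_mem_flagChains (filter_not_mem_flagChains hz.1 x))

/-- An element `x` with a greatest smaller element `y` can be removed without loss of cycles. -/
theorem flagCycles_le_of_removable {U : Set X} {x y : X} (hy : y ∈ U) (hyx : y < x)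
    (h : ∀ w ∈ U, w < x → w ≤ y) (q : ℤ) :
    flagCycles R U q ≤ flagCycles R (U \ {x}) q ⊔ flagBoundaries R U q := by
  classical
  intro z hz
  set zx := z.filter (fun s => x ∈ s.1) with hzx
  have hzxU : zx ∈ flagChains R U q := filter_mem_flagChains hz.1 x
  have hb : boundary R X (insertChain R y zx) ∈ flagBoundaries R U q :=
    ⟨_, insertChain_mem_flagChains hy hzxU, rfl⟩
  -- Flags through `x` are compatible with `y`, so up to a boundary the part of `z` through `x` may
  -- be replaced by `y * ∂zx`. This avoids `x`, because `∂zx` is minus the boundary of the part of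
  -- `z` off `x`.
  have hcomp := boundary_insertChain_add R (y := y) (z := zx) (by
    intro s hs w hw
    have hxs : x ∈ s.1 := by
      rw [hzx, Finsupp.support_filter, Finset.mem_filter] at hs
      exact hs.2
    rcases s.2.total hw hxs with hwx | hxw
    · rcases hwx.eq_or_lt with rfl | hwx
      · exact Or.inr hyx.le
      · exact Or.inl (h w ((mem_flagChains.1 hzxU s hs).1 w hw) hwx)
    · exact Or.inr (hyx.le.trans hxw))
  have hsplit : z = z.filter (fun s => x ∉ s.1) + insertChain R y (boundary R X zx) +
      boundary R X (insertChain R y zx) := by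
    rw [add_assoc, add_comm (insertChain R y _), hcomp, add_comm]
    exact (Finsupp.filter_add_filter_not z _).symm
  have hU : z.filter (fun s => x ∉ s.1) + insertChain R y (boundary R X zx) ∈
      flagChains R (U \ {x}) q := by
    refine Submodule.add_mem _ (filter_not_mem_flagChains hz.1 x) ?_
    have := insertChain_mem_flagChains (U := U \ {x}) (y := y) ⟨hy, hyx.ne⟩
      (boundary_filter_mem_flagChains hz x)
    rwa [sub_add_cancel] at this
  refine Submodule.mem_sup.2 ⟨_, ⟨hU, ?_⟩, _, hb, hsplit.symm⟩
  rw [ eq_sub_of_add_eq hsplit.symm]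
  exact Submodule.sub_mem _ hz.2 (flagBoundaries_le_ker U q hb)

/-- A finite set `U` with an element `a` such that for each `x` in `U` the elements of `U` below
both `x` and `a` have a greatest member is acyclic. -/
theorem flagCycles_le_flagBoundaries [Finite X] {U : Set X} {a : X} (ha : a ∈ U)
    (h : ∀ x ∈ U, ∃ y ∈ U, y ≤ x ∧ y ≤ a ∧ ∀ w ∈ U, w ≤ x → w ≤ a → w ≤ y) (q : ℤ) :
    flagCycles R U q ≤ flagBoundaries R U q := by
  induction hm : {x ∈ U | ¬ x ≤ a}.ncard generalizing U with
  | zero =>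
    rw [Set.ncard_eq_zero] at hm
    refine flagCycles_le_of_cone ha (fun x hx => Or.inl ?_) q
    by_contra hxa
    exact (Set.eq_empty_iff_forall_notMem.1 hm x) ⟨hx, hxa⟩
  | succ m ih =>
    have hne : {x ∈ U | ¬ x ≤ a}.Nonempty := by
      rw [← Set.ncard_pos]
      omega
    -- Minimality puts everything smaller than `x` below `a`, so the greatest common lower bound of
    -- `x` and `a` is the greatest element below `x`, and `x` is removable.
    obtain ⟨x, hx⟩ := (Set.toFinite {x ∈ U | ¬ x ≤ a}).exists_minimal hne
    have hxU := hx.prop.1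
    have hxa := hx.prop.2
    have hlt : ∀ w ∈ U, w < x → w ≤ a := fun w hw hwx => by
      by_contra hwa
      exact (hx.not_prop_of_lt hwx) ⟨hw, hwa⟩
    obtain ⟨y, hyU, hyx, hya, hymax⟩ := h x hxU
    have hyx' : y < x := lt_of_le_of_ne hyx fun e => hxa (e ▸ hya)
    refine (flagCycles_le_of_removable hyU hyx'
      (fun w hw hwx => hymax w hw hwx.le (hlt w hw hwx)) q).trans (sup_le ?_ le_rfl)
    refine (ih (U := U \ {x}) ⟨ha, fun e => hxa (Set.mem_singleton_iff.1 e ▸ le_rfl)⟩ ?_ ?_).trans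
      (flagBoundaries_mono Set.sdiff_subset q)
    · intro w hw
      obtain ⟨v, hv, h1, h2, h3⟩ := h w hw.1
      exact ⟨v, ⟨hv, fun e => hxa (Set.mem_singleton_iff.1 e ▸ h2)⟩, h1, h2,
        fun u hu => h3 u hu.1⟩
    · have : {w ∈ U \ {x} | ¬ w ≤ a} = {w ∈ U | ¬ w ≤ a} \ {x} := by
        ext w
        simp only [Set.mem_ofPred_eq, Set.mem_sdiff, Set.mem_singleton_iff]
        tauto
      rw [this, Set.ncard_sdiff_singleton_of_mem hx.prop, hm]
      rfl

/-- The chains generated by boundaries in `V` and by cycles in the sets `V ∩ M s` with `s ∈ S`. -/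
noncomputable def spannedCycles {ι : Type*} (R : Type*) [CommRing R] (M : ι → Set X) (S : Set ι)
    (V : Set X) (q : ℤ) : Submodule R (FinFlag X →₀ R) :=
  flagBoundaries R V q ⊔ ⨆ s ∈ S, flagCycles R (V ∩ M s) q

theorem spannedCycles_le_ker {ι : Type*} (M : ι → Set X) (S : Set ι) (V : Set X) (q : ℤ) :
    spannedCycles R M S V q ≤ LinearMap.ker (boundary R X) :=
  sup_le (flagBoundaries_le_ker V q) (iSup₂_le fun _ _ => inf_le_right)

theorem flagCycles_le_spannedCycles {ι : Type*} {M : ι → Set X} {S : Set ι} (V : Set X) (q : ℤ)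
    {s : ι} (hs : s ∈ S) : flagCycles R (V ∩ M s) q ≤ spannedCycles R M S V q :=
  le_sup_of_le_right (le_iSup₂_of_le s hs le_rfl)

theorem spannedCycles_mono {ι : Type*} {M : ι → Set X} {S T : Set ι} (h : S ⊆ T) (V : Set X)
    (q : ℤ) : spannedCycles R M S V q ≤ spannedCycles R M T V q :=
  sup_le_sup_left (biSup_mono h) _

/-- Removal of a minimal element `e`: if the cycles of the link of `e` are spanned by cycles in
the sets `M s` that are boundaries there, then no cycles are lost. -/
theorem flagCycles_le_of_minimal {ι : Type*} {M : ι → Set X} {S T : Set ι} {U V : Set X} {e : X}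
    {q : ℤ} (hUV : U ⊆ V) (heU : e ∈ U) (hmin : ∀ x ∈ U, ¬ x < e) (hTS : T ⊆ S)
    (hspan : flagCycles R (U ∩ Set.Ioi e) (q - 1) ≤
      spannedCycles R M T (U ∩ Set.Ioi e) (q - 1))
    (heM : ∀ s ∈ T, e ∈ M s)
    (hbd : ∀ s ∈ T, flagCycles R (U ∩ Set.Ioi e ∩ M s) (q - 1) ≤
      flagBoundaries R ((U \ {e}) ∩ M s) (q - 1))
    (hU : flagCycles R (U \ {e}) q ≤ spannedCycles R M S V q) :
    flagCycles R U q ≤ spannedCycles R M S V q := by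
  classical
  intro z hz
  set ze := z.filter (fun s => e ∈ s.1) with hze
  have hzeU : ze ∈ flagChains R U q := filter_mem_flagChains hz.1 e
  have hmem : ∀ s ∈ ze.support, e ∈ s.1 := fun s hs => by
    rw [hze, Finsupp.support_filter, Finset.mem_filter] at hs
    exact hs.2
  have hle : ∀ s ∈ ze.support, ∀ x ∈ s.1, e ≤ x := fun s hs x hx => by
    rcases s.2.total (hmem s hs) hx with h | h
    · exact h
    · rcases h.eq_or_lt with rfl | h
      · exact le_rfl
      · exact absurd h (hmin x ((mem_flagChains.1 hzeU s hs).1 x hx))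
  -- All flags of `ze` contain `e`, so `ze` is the cone over its own boundary, which is a cycle of
  -- the link.
  have hins : insertChain R e (boundary R X ze) = ze := by
    have h0 : insertChain R e ze = 0 := map_mem_of_support R (N := ⊥) fun s hs => by
      rw [insertChain_single, insertFlag_of_mem R (hmem s hs), smul_zero]
      exact Submodule.zero_mem _
    have := boundary_insertChain_add R (y := e) (z := ze) fun s hs x hx => Or.inr (hle s hs x hx)
    rwa [h0, map_zero, zero_add] at this
  have hw : boundary R X ze ∈ flagCycles R (U ∩ Set.Ioi e) (q - 1) := by
    refine ⟨mem_flagChains.2 fun s hs => ?_, boundary_boundary ze⟩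
    have h1 := mem_flagChains.1 (boundary_filter_mem_flagChains hz e) s hs
    have h2 : ze ∈ flagChains R (Set.Ici e) q :=
      mem_flagChains.2 fun s hs => ⟨hle s hs, (mem_flagChains.1 hzeU s hs).2⟩
    have h3 := mem_flagChains.1 (boundary_mem_flagChains h2) s hs
    exact ⟨fun x hx => ⟨(h1.1 x hx).1, lt_of_le_of_ne (h3.1 x hx)
      fun h => (h1.1 x hx).2 h.symm⟩, h1.2⟩
  have hsub : U ∩ Set.Ioi e ⊆ U \ {e} := fun x hx => ⟨hx.1, fun h => hx.2.ne' h⟩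
  have hcone : ∀ {r : ℤ} {u : FinFlag X →₀ R}, u ∈ flagChains R (U ∩ Set.Ioi e) r →
      boundary R X (insertChain R e u) + insertChain R e (boundary R X u) = u := fun hu =>
    boundary_insertChain_add R fun s hs x hx => Or.inr ((mem_flagChains.1 hu s hs).1 x hx).2.le
  -- Coning the generators of the link: for a boundary, `e * ∂u = u - ∂(e * u)`; for a cycle `v =
  -- ∂y` with `y` in `M s` off `e`, `e * v = (e * v - y) + y`, and `e * v - y` is a cycle in `M s`.
  have hcomap : spannedCycles R M T (U ∩ Set.Ioi e) (q - 1) ≤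
      (flagChains R (U \ {e}) q ⊔ spannedCycles R M S V q).comap (insertChain R e) := by
    refine sup_le ?_ (iSup₂_le fun s hs => ?_)
    · rintro _ ⟨u, hu, rfl⟩
      rw [sub_add_cancel] at hu
      rw [Submodule.mem_comap, eq_sub_of_add_eq' (hcone hu)]
      refine Submodule.sub_mem _ (Submodule.mem_sup_left (flagChains_mono hsub q hu))
        (Submodule.mem_sup_right (Submodule.mem_sup_left ⟨_, ?_, rfl⟩))
      exact insertChain_mem_flagChains (hUV heU)
        (flagChains_mono (Set.inter_subset_left.trans hUV) q hu)
    · intro v hv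
      obtain ⟨y, hy, hyv⟩ := hbd s hs hv
      rw [sub_add_cancel] at hy
      rw [Submodule.mem_comap, ← sub_add_cancel (insertChain R e v) y]
      refine Submodule.add_mem _ (Submodule.mem_sup_right (Submodule.mem_sup_right ?_))
        (Submodule.mem_sup_left (flagChains_mono Set.inter_subset_left q hy))
      refine Submodule.mem_iSup_of_mem s (Submodule.mem_iSup_of_mem (hTS hs) ⟨?_, ?_⟩)
      · refine Submodule.sub_mem _ ?_ (flagChains_mono
          (Set.inter_subset_inter_left _ (Set.sdiff_subset.trans hUV)) q hy)
        have := insertChain_mem_flagChains (U := V ∩ M s) ⟨hUV heU, heM s hs⟩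
          (flagChains_mono (Set.inter_subset_inter_left _ (Set.inter_subset_left.trans hUV)) _ hv.1)
        rwa [sub_add_cancel] at this
      · have h1 := hcone (flagChains_mono Set.inter_subset_left _ hv.1)
        rw [LinearMap.mem_ker.1 hv.2, map_zero, add_zero] at h1
        change boundary R X _ = 0
        rw [map_sub, h1, hyv, sub_self]
  have hzmem : z ∈ flagChains R (U \ {e}) q ⊔ spannedCycles R M S V q := by
    rw [← Finsupp.filter_add_filter_not z (fun s : FinFlag X => e ∈ s.1)]
    refine Submodule.add_mem _ ?_ (Submodule.mem_sup_left (filter_not_mem_flagChains hz.1 e))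
    have := hcomap (hspan hw)
    rwa [Submodule.mem_comap, hins] at this
  -- The summand `g` is a cycle, so `c` is a cycle too, and it avoids `e`.
  obtain ⟨c, hc, g, hg, rfl⟩ := Submodule.mem_sup.1 hzmem
  refine Submodule.add_mem _ (hU ⟨hc, ?_⟩) hg
  have := Submodule.sub_mem _ hz.2 (spannedCycles_le_ker M S V q hg)
  rwa [add_sub_cancel_right] at this

end PosetHomology

/-! ### Moved points, one-block partitions and atoms. -/

namespace KEqual

open PosetHomology

variable {n k : ℕ}

instance : Finite (PiLattice n k) :=
  Finite.of_injective (fun r : PiLattice n k => fun x y => r.1 x y) fun _ _ h =>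
    Subtype.ext (Setoid.ext fun x y => iff_of_eq (congrFun (congrFun h x) y))

/-- The point `x` lies in a non-trivial block of `r`. -/
def Moves (r : PiLattice n k) (x : Fin n) : Prop := ∃ y, y ≠ x ∧ r.1 x y

theorem PiLattice.le_iff {r s : PiLattice n k} : r ≤ s ↔ ∀ x y, r.1 x y → s.1 x y :=
  ⟨fun h _ _ hxy => h hxy, fun h _ _ hxy => h _ _ hxy⟩

theorem Moves.mono {r s : PiLattice n k} (h : r ≤ s) {x : Fin n} : Moves r x → Moves s x :=
  fun ⟨y, hy, hxy⟩ => ⟨y, hy, h hxy⟩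

theorem Moves.le_ncard {r : PiLattice n k} {x : Fin n} (h : Moves r x) :
    k ≤ {y | r.1 x y}.ncard := by
  obtain ⟨y, hy, hxy⟩ := h
  have hset : {z | r.1 x z} = {z | r.1 z x} := Set.ext fun z => ⟨r.1.symm, r.1.symm⟩
  rw [hset]
  rcases r.2 _ ⟨x, rfl⟩ with h1 | h1
  · obtain ⟨w, hw⟩ := Set.ncard_eq_one.1 h1
    have h2 : x ∈ {z | r.1 z x} := r.1.refl x
    have h3 : y ∈ {z | r.1 z x} := r.1.symm hxy
    rw [hw] at h2 h3
    exact absurd (h3.trans h2.symm) hy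
  · exact h1

theorem eq_of_not_moves {r : PiLattice n k} {x y : Fin n} (h : ¬ Moves r x) (hxy : r.1 x y) :
    y = x := by
  by_contra hne
  exact h ⟨y, hne, hxy⟩

/-- A partition belongs to `PiLattice n k` if the blocks of points with a partner are large. -/
theorem blocks_of_le_ncard {r : Setoid (Fin n)}
    (h : ∀ x y, y ≠ x → r x y → k ≤ {z | r x z}.ncard) :
    ∀ b ∈ r.classes, b.ncard = 1 ∨ k ≤ b.ncard := by
  rintro b ⟨x, rfl⟩
  have hset : {z | r x z} = {z | r z x} := Set.ext fun z => ⟨r.symm, r.symm⟩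
  by_cases hx : ∃ y, y ≠ x ∧ r x y
  · obtain ⟨y, hy, hxy⟩ := hx
    exact Or.inr (hset ▸ h x y hy hxy)
  · left
    push Not at hx
    refine Set.ncard_eq_one.2 ⟨x, Set.ext fun y => ⟨fun hy => ?_, ?_⟩⟩
    · by_contra hne
      exact hx y hne (r.symm hy)
    · rintro rfl
      exact r.refl _

/-- The partition whose only possibly non-trivial block is `S`. -/
def oneBlock (S : Set (Fin n)) (hS : k ≤ S.ncard) : PiLattice n k :=
  ⟨⟨fun x y => x = y ∨ (x ∈ S ∧ y ∈ S), fun _ => Or.inl rfl,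
    fun h => h.imp Eq.symm And.symm, by
      rintro x y z (rfl | h) (rfl | h')
      · exact Or.inl rfl
      · exact Or.inr h'
      · exact Or.inr h
      · exact Or.inr ⟨h.1, h'.2⟩⟩,
    blocks_of_le_ncard fun x y hne h => by
      rcases h with h | h
      · exact absurd h.symm hne
      · exact hS.trans (Set.ncard_le_ncard (fun z hz => Or.inr ⟨h.1, hz⟩) (Set.toFinite _))⟩

theorem oneBlock_le {S : Set (Fin n)} {hS : k ≤ S.ncard} {r : PiLattice n k} :
    oneBlock S hS ≤ r ↔ ∀ x ∈ S, ∀ y ∈ S, r.1 x y := by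
  rw [PiLattice.le_iff]
  refine ⟨fun h x hx y hy => h x y (Or.inr ⟨hx, hy⟩), fun h x y hxy => ?_⟩
  rcases hxy with rfl | hxy
  · exact r.1.refl _
  · exact h x hxy.1 y hxy.2

/-- The partitions below the one that isolates `i` are those with the block `{i}`. -/
theorem le_isolate {i : Fin n} {hi : k ≤ ({i}ᶜ : Set (Fin n)).ncard} {r : PiLattice n k} :
    r ≤ oneBlock {i}ᶜ hi ↔ ¬ Moves r i := by
  rw [PiLattice.le_iff]
  constructor
  · rintro h ⟨y, hy, hiy⟩
    rcases h i y hiy with h | h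
    · exact hy h.symm
    · exact h.1 rfl
  · intro h x y hxy
    by_cases hxi : x = i
    · subst hxi
      exact Or.inl (eq_of_not_moves h hxy).symm
    · by_cases hyi : y = i
      · subst hyi
        exact Or.inl (eq_of_not_moves h (r.1.symm hxy))
      · exact Or.inr ⟨hxi, hyi⟩

theorem bot_rel {x y : Fin n} : (⊥ : PiLattice n k).1 x y ↔ x = y := by
  constructor
  · intro h
    have : (⊥ : PiLattice n k) ≤
        ⟨⊥, blocks_of_le_ncard fun x y hne h => absurd h.symm hne⟩ := bot_le
    exact this h
  · rintro rfl
    exact (⊥ : PiLattice n k).1.refl _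

theorem not_moves_bot (x : Fin n) : ¬ Moves (⊥ : PiLattice n k) x :=
  fun ⟨_, hy, h⟩ => hy (bot_rel.1 h).symm

theorem ne_bot_iff {r : PiLattice n k} : r ≠ ⊥ ↔ ∃ x, Moves r x := by
  constructor
  · intro h
    by_contra hx
    push Not at hx
    exact h (le_bot_iff.1 (PiLattice.le_iff.2 fun x y hxy =>
      bot_rel.2 (eq_of_not_moves (hx x) hxy).symm))
  · rintro ⟨x, hx⟩ rfl
    exact not_moves_bot x hx

theorem top_rel (hkn : k ≤ n) (x y : Fin n) : (⊤ : PiLattice n k).1 x y := by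
  have : oneBlock (k := k) (Set.univ : Set (Fin n)) (by simpa [Set.ncard_univ] using hkn) ≤ ⊤ :=
    le_top
  exact oneBlock_le.1 this x trivial y trivial

theorem moves_oneBlock (hk : 2 ≤ k) {S : Set (Fin n)} {hS : k ≤ S.ncard} {x : Fin n} (hx : x ∈ S) :
    Moves (oneBlock S hS) x := by
  obtain ⟨y, hy, hne⟩ := Set.exists_ne_of_one_lt_ncard (by omega : 1 < S.ncard) x
  exact ⟨y, hne, Or.inr ⟨hx, hy⟩⟩

theorem mem_of_moves_oneBlock {S : Set (Fin n)} {hS : k ≤ S.ncard} {x : Fin n}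
    (h : Moves (oneBlock S hS) x) : x ∈ S := by
  obtain ⟨y, hy, h | h⟩ := h
  · exact absurd h.symm hy
  · exact h.1

theorem oneBlock_ne_bot (hk : 2 ≤ k) {S : Set (Fin n)} (hS : k ≤ S.ncard) :
    oneBlock S hS ≠ ⊥ := by
  obtain ⟨x, hx⟩ := Set.nonempty_of_ncard_ne_zero (by omega : S.ncard ≠ 0)
  exact ne_bot_iff.2 ⟨x, moves_oneBlock hk hx⟩

theorem isAtom_oneBlock (hk : 2 ≤ k) {S : Set (Fin n)} (hS : S.ncard = k) :
    IsAtom (oneBlock S hS.ge) := by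
  refine ⟨oneBlock_ne_bot hk _, fun b hb => ?_⟩
  by_contra hne
  obtain ⟨x, hx⟩ := ne_bot_iff.1 hne
  have hxS : x ∈ S := mem_of_moves_oneBlock (hx.mono hb.le)
  have hsub : {y | b.1 x y} ⊆ S := fun y hy => by
    rcases hb.le hy with h | h
    · exact h ▸ hxS
    · exact h.2
  have heq : {y | b.1 x y} = S :=
    Set.eq_of_subset_of_ncard_le hsub (hS ▸ hx.le_ncard) (Set.toFinite _)
  refine hb.not_ge (oneBlock_le.2 fun u hu v hv => ?_)
  rw [← heq] at hu hv
  exact b.1.trans (b.1.symm hu) hv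

/-- An atom is the one-block partition of each of its non-trivial blocks. -/
theorem le_of_isAtom (hk : 2 ≤ k) {t r : PiLattice n k} (ht : IsAtom t) {x : Fin n}
    (hx : Moves t x) (h : ∀ y, t.1 x y → r.1 x y) : t ≤ r := by
  have h1 : oneBlock {y | t.1 x y} hx.le_ncard ≤ t :=
    oneBlock_le.2 fun u hu v hv => t.1.trans (t.1.symm hu) hv
  rw [← (ht.le_iff.1 h1).resolve_left (oneBlock_ne_bot hk _)]
  exact oneBlock_le.2 fun u hu v hv => r.1.trans (r.1.symm (h u hu)) (h v hv)

theorem exists_atom_le (hk : 2 ≤ k) {r : PiLattice n k} {u v : Fin n} (huv : r.1 u v)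
    (hne : u ≠ v) : ∃ t, IsAtom t ∧ t ≤ r ∧ t.1 u v := by
  have hm : Moves r u := ⟨v, hne.symm, huv⟩
  obtain ⟨T, hT1, hT2, hT3⟩ := Set.exists_subsuperset_card_eq (s := {u, v}) (t := {y | r.1 u y})
    (by rintro x (rfl | rfl)
        · exact r.1.refl _
        · exact huv)
    (by rw [Set.ncard_pair hne]; exact hk) hm.le_ncard
  refine ⟨oneBlock T hT3.ge, isAtom_oneBlock hk hT3, oneBlock_le.2 fun x hx y hy =>
    r.1.trans (r.1.symm (hT2 hx)) (hT2 hy), Or.inr ⟨hT1 (by simp), hT1 (by simp)⟩⟩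

/-- The lattice is atomistic: two distinct points of a block lie in a common `k`-subset of it, since
`k ≥ 2`. -/
theorem le_of_forall_atom (hk : 2 ≤ k) {r s : PiLattice n k}
    (h : ∀ t, IsAtom t → t ≤ r → t ≤ s) : r ≤ s := by
  refine PiLattice.le_iff.2 fun u v huv => ?_
  by_cases hne : u = v
  · exact hne ▸ s.1.refl _
  · obtain ⟨t, ht, htr, htuv⟩ := exists_atom_le hk huv hne
    exact h t ht htr htuv

/-! ### The posets of joins of atoms. -/

section joins

variable {s : Set (PiLattice n k)}

/-- Membership means being the join of all admissible atoms below; expressed through upper bounds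
`D`, no set of atoms has to be chosen. -/
theorem mem_joinsOfAtoms_iff {C : PiLattice n k} : C ∈ joinsOfAtoms s ↔
    ∀ D, (∀ t, IsAtom t → (∃ A ∈ s, t ≤ A) → t ≤ C → t ≤ D) → C ≤ D := by
  constructor
  · rintro ⟨τ, hτ, rfl⟩ D hD
    exact sSup_le fun t ht => hD t (hτ t ht).1 (hτ t ht).2 (le_sSup ht)
  · intro h
    refine ⟨{t | IsAtom t ∧ (∃ A ∈ s, t ≤ A) ∧ t ≤ C}, fun a ha => ⟨ha.1, ha.2.1⟩,
      le_antisymm (h _ fun t h1 h2 h3 => le_sSup ⟨h1, h2, h3⟩) (sSup_le fun t ht => ht.2.2)⟩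

theorem sSup_mem_joinsOfAtoms {Z : Set (PiLattice n k)} (h : Z ⊆ joinsOfAtoms s) :
    sSup Z ∈ joinsOfAtoms s :=
  mem_joinsOfAtoms_iff.2 fun D hD => sSup_le fun _ hz => mem_joinsOfAtoms_iff.1 (h hz) D
    fun t h1 h2 h3 => hD t h1 h2 (h3.trans (le_sSup hz))

theorem sup_mem_joinsOfAtoms {x y : PiLattice n k} (hx : x ∈ joinsOfAtoms s)
    (hy : y ∈ joinsOfAtoms s) : x ⊔ y ∈ joinsOfAtoms s := by
  rw [← sSup_pair]
  exact sSup_mem_joinsOfAtoms (by rintro z (rfl | rfl) <;> assumption)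

theorem mem_joinsOfAtoms_of_le (hk : 2 ≤ k) {A x : PiLattice n k} (hA : A ∈ s) (hx : x ≤ A) :
    x ∈ joinsOfAtoms s :=
  mem_joinsOfAtoms_iff.2 fun _ hD => le_of_forall_atom hk fun t ht htx =>
    hD t ht ⟨A, hA, htx.trans hx⟩ htx

/-- Every block of `d` lies in a block of some member of `s`. -/
def BlocksSubordinate (s : Set (PiLattice n k)) (d : PiLattice n k) : Prop :=
  ∀ x, ∃ A ∈ s, ∀ y, d.1 x y → A.1 x y

theorem BlocksSubordinate.mono {d e : PiLattice n k} (h : BlocksSubordinate s e) (hde : d ≤ e) :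
    BlocksSubordinate s d := fun x =>
  let ⟨A, hA, hx⟩ := h x
  ⟨A, hA, fun y hy => hx y (hde hy)⟩

/-- An atom below `d` has its only non-trivial block inside a block of `d`, hence inside a block of
a member of `s`. -/
theorem BlocksSubordinate.mem_joinsOfAtoms (hk : 2 ≤ k) {d : PiLattice n k}
    (h : BlocksSubordinate s d) : d ∈ joinsOfAtoms s :=
  mem_joinsOfAtoms_iff.2 fun _ hD => le_of_forall_atom hk fun t ht htd => by
    obtain ⟨x, hx⟩ := ne_bot_iff.1 ht.1
    obtain ⟨A, hA, hxA⟩ := h x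
    exact hD t ht ⟨A, hA, le_of_isAtom hk ht hx fun y hy => hxA y (htd hy)⟩ htd

/-- At most one member of `s` has `i` in a non-trivial block. -/
def MovedOnce (s : Set (PiLattice n k)) (i : Fin n) : Prop :=
  ∀ A ∈ s, ∀ B ∈ s, Moves A i → Moves B i → A = B

/-- Above an element `e` that moves `i`, there is room for an element that fixes `i` and does
not lie below `d`. -/
theorem exists_joinsOfAtoms_not_le (hk : 2 ≤ k) {d e x : PiLattice n k} {i : Fin n}
    (hi : MovedOnce s i) (hde : d ≤ e) (hex : e < x) (hx : x ∈ joinsOfAtoms s) (hei : Moves e i)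
    (hse : BlocksSubordinate s e) :
    ∃ z ∈ joinsOfAtoms s, z ≤ x ∧ ¬ Moves z i ∧ ¬ z ≤ d := by
  obtain ⟨F, hF, hFi⟩ := hse i
  have hFm : Moves F i := by
    obtain ⟨y, hy, hiy⟩ := hei
    exact ⟨y, hy, hFi y hiy⟩
  obtain ⟨t, ht, ⟨A, hA, htA⟩, htx, hte⟩ : ∃ t, IsAtom t ∧ (∃ A ∈ s, t ≤ A) ∧ t ≤ x ∧ ¬ t ≤ e := by
    by_contra hcon
    push Not at hcon
    exact hex.not_ge (mem_joinsOfAtoms_iff.1 hx e fun t h1 h2 h3 => hcon t h1 h2 h3)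
  by_cases hti : Moves t i
  · obtain rfl : A = F := hi A hA F hF (hti.mono htA) hFm
    obtain ⟨y, hty, hey⟩ : ∃ y, t.1 i y ∧ ¬ e.1 i y := by
      by_contra hcon
      push Not at hcon
      exact hte (le_of_isAtom hk ht hti hcon)
    -- `β` contains the `e`-block of `i` and the new point `y`, so at least `k + 1` points: `i` can
    -- be dropped and an admissible block remains. It still joins `y` to the `e`-block of `i`, so it
    -- cannot lie below `d`.
    set β : Set (Fin n) := {y | x.1 i y ∧ A.1 i y}
    have hsub : insert y {y | e.1 i y} ⊆ β := by
      rintro w (rfl | hw)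
      · exact ⟨htx hty, htA hty⟩
      · exact ⟨hex.le hw, hFi w hw⟩
    have hcard : k + 1 ≤ β.ncard := by
      refine le_trans ?_ (Set.ncard_le_ncard hsub (Set.toFinite _))
      rw [Set.ncard_insert_of_notMem (s := {y | e.1 i y}) hey (Set.toFinite _)]
      exact Nat.succ_le_succ hei.le_ncard
    have hiβ : i ∈ β := ⟨x.1.refl _, A.1.refl _⟩
    have hcard' : k ≤ (β \ {i}).ncard := by
      rw [Set.ncard_sdiff_singleton_of_mem hiβ]
      omega
    refine ⟨oneBlock (β \ {i}) hcard', mem_joinsOfAtoms_of_le hk hA (oneBlock_le.2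
      fun u hu v hv => A.1.trans (A.1.symm hu.1.2) hv.1.2), oneBlock_le.2
      fun u hu v hv => x.1.trans (x.1.symm hu.1.1) hv.1.1,
      fun h => (mem_of_moves_oneBlock h).2 rfl, fun hle => hey ?_⟩
    obtain ⟨w, hw, hiw⟩ := hei
    have hyi : y ≠ i := fun h => hey (h ▸ e.1.refl _)
    have h1 := oneBlock_le.1 hle w ⟨hsub (Or.inr hiw), hw⟩ y ⟨hsub (Or.inl rfl), hyi⟩
    exact e.1.trans hiw (hde h1)
  · exact ⟨t, mem_joinsOfAtoms_of_le hk hA htA, htx, hti, fun h => hte (h.trans hde)⟩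

end joins

end KEqual

/-! ### The acyclic part of an interval and the inductive step. -/

namespace KEqual

open PosetHomology

variable {n k : ℕ} {R : Type*} [CommRing R]

/-- The elements of `Π_s` strictly between `d` and `⊤` that lie above an element of `Π_s` which
is greater than `d` and fixes `i`. -/
def aboveFixing (s : Set (PiLattice n k)) (d : PiLattice n k) (i : Fin n) : Set (PiLattice n k) :=
  {x | x ∈ joinsOfAtoms s ∧ x < ⊤ ∧ ∃ z ∈ joinsOfAtoms s, d < z ∧ z ≤ x ∧ ¬ Moves z i}

theorem aboveFixing_subset_Ioo (s : Set (PiLattice n k)) (d : PiLattice n k) (i : Fin n) :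
    aboveFixing s d i ⊆ Set.Ioo d ⊤ := fun _ ⟨_, h2, _, _, h3, h4, _⟩ => ⟨h3.trans_le h4, h2⟩

/-- Fixing `i` means lying below the partition that isolates `i`, so it is preserved by joins. Hence
`m x`, the join of all members of `Π_s` below `x` that fix `i`, is the greatest such member, and it
is also the greatest common lower bound of `x` and `m ⊤` within the set. -/
theorem flagCycles_aboveFixing_le {s : Set (PiLattice n k)} {d : PiLattice n k} {i : Fin n}
    (hi : k ≤ ({i}ᶜ : Set (Fin n)).ncard) (hitop : Moves (⊤ : PiLattice n k) i)
    (hne : ∃ z ∈ joinsOfAtoms s, d < z ∧ ¬ Moves z i) (q : ℤ) :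
    flagCycles R (aboveFixing s d i) q ≤ flagBoundaries R (aboveFixing s d i) q := by
  set m : PiLattice n k → PiLattice n k := fun x =>
    sSup {z | z ∈ joinsOfAtoms s ∧ z ≤ x ∧ ¬ Moves z i} with hm
  have hmJ : ∀ x, m x ∈ joinsOfAtoms s := fun x => sSup_mem_joinsOfAtoms fun z hz => hz.1
  have hmx : ∀ x, m x ≤ x := fun x => sSup_le fun z hz => hz.2.1
  have hmi : ∀ x, ¬ Moves (m x) i := fun x =>
    le_isolate.1 (sSup_le fun z hz => (le_isolate (hi := hi)).2 hz.2.2)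
  have hlt : ∀ x, ¬ Moves x i → x < ⊤ := fun x hx => lt_top_iff_ne_top.2 fun h => hx (h ▸ hitop)
  have hle : ∀ {x z}, z ∈ joinsOfAtoms s → z ≤ x → ¬ Moves z i → z ≤ m x := fun h1 h2 h3 =>
    le_sSup ⟨h1, h2, h3⟩
  have hmem : ∀ {x z}, z ∈ joinsOfAtoms s → d < z → z ≤ x → ¬ Moves z i →
      m x ∈ aboveFixing s d i := fun {x z} h1 h2 h3 h4 =>
    ⟨hmJ x, hlt _ (hmi x), m x, hmJ x, h2.trans_le (hle h1 h3 h4), le_rfl, hmi x⟩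
  obtain ⟨z, hz1, hz2, hz3⟩ := hne
  refine flagCycles_le_flagBoundaries (a := m ⊤) (hmem hz1 hz2 le_top hz3) ?_ q
  rintro x ⟨-, -, z, hz1, hz2, hz3, hz4⟩
  exact ⟨m x, hmem hz1 hz2 hz3 hz4, hmx x, hle (hmJ x) le_top (hmi x),
    fun w hw hwx hwm => hle hw.1 hwx fun h => hmi ⊤ (h.mono hwm)⟩

/-- With `s = {⊤}` the results on `Π_s` apply to the whole lattice. -/
theorem mem_joinsOfAtoms_top (hk : 2 ≤ k) (x : PiLattice n k) :
    x ∈ joinsOfAtoms ({⊤} : Set (PiLattice n k)) :=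
  mem_joinsOfAtoms_of_le hk rfl le_top

/-- The cycles of the interval above `d` are spanned by cycles in the subposets `Π_s` if the same
holds, one dimension lower, for the intervals above the covers of `d` that move `i`. -/
theorem flagCycles_Ioo_le_spannedCycles (hk : 2 ≤ k) {d : PiLattice n k} {i : Fin n}
    (hi : k ≤ ({i}ᶜ : Set (Fin n)).ncard) (hitop : Moves (⊤ : PiLattice n k) i)
    (hdi : ¬ Moves d i) (hda : d ≠ oneBlock {i}ᶜ hi) {S : Set (Set (PiLattice n k))}
    (hS : ∀ s ∈ S, ⊤ ∈ joinsOfAtoms s) (q : ℤ)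
    (h : ∀ e, d ⋖ e → e < ⊤ → Moves e i → flagCycles R (Set.Ioo e ⊤) (q - 1) ≤
      spannedCycles R joinsOfAtoms {s ∈ S | BlocksSubordinate s e ∧ MovedOnce s i}
        (Set.Ioo e ⊤) (q - 1)) :
    flagCycles R (Set.Ioo d ⊤) q ≤
      spannedCycles R joinsOfAtoms {s ∈ S | BlocksSubordinate s d} (Set.Ioo d ⊤) q := by
  set Q := aboveFixing ({⊤} : Set (PiLattice n k)) d i with hQ
  have hQsub : Q ⊆ Set.Ioo d ⊤ := aboveFixing_subset_Ioo _ _ _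
  have hJ := mem_joinsOfAtoms_top (n := n) hk
  -- Only covers of `d` can lie outside `Q`, and the link of such a cover is its full upper
  -- interval.
  have hup : ∀ {e x : PiLattice n k}, d < e → e < x → x < ⊤ → x ∈ Q := by
    intro e x hde hex hx
    refine ⟨hJ x, hx, ?_⟩
    by_cases hei : Moves e i
    · obtain ⟨z, -, hzx, hzi, hzd⟩ := exists_joinsOfAtoms_not_le (s := {⊤}) hk
        (by rintro A rfl B rfl _ _; rfl) hde.le hex (hJ x) hei
        (fun x => ⟨⊤, rfl, fun y hy => (le_top : e ≤ ⊤) hy⟩)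
      refine ⟨d ⊔ z, hJ _, left_lt_sup.2 hzd, sup_le (hde.le.trans hex.le) hzx, ?_⟩
      exact le_isolate.1 (sup_le ((le_isolate (hi := hi)).2 hdi) (le_isolate.2 hzi))
    · exact ⟨e, hJ _, hde, hex.le, hei⟩
  have hQacyc : flagCycles R Q q ≤ flagBoundaries R Q q :=
    flagCycles_aboveFixing_le hi hitop ⟨oneBlock {i}ᶜ hi, hJ _,
      lt_of_le_of_ne (le_isolate.2 hdi) hda, le_isolate.1 le_rfl⟩ q
  -- The missing covers are added to `Q` one at a time, each as a minimal element.
  have key : ∀ E : Set (PiLattice n k), E ⊆ Set.Ioo d ⊤ \ Q → flagCycles R (Q ∪ E) q ≤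
      spannedCycles R joinsOfAtoms {s ∈ S | BlocksSubordinate s d} (Set.Ioo d ⊤) q := by
    intro E
    induction E, Set.toFinite E using Set.Finite.induction_on with
    | empty =>
      intro _
      rw [Set.union_empty]
      exact hQacyc.trans ((flagBoundaries_mono hQsub q).trans le_sup_left)
    | @insert e E heE _ ih =>
      intro hE
      obtain ⟨he, heQ⟩ := hE (Set.mem_insert e E)
      have hE' : E ⊆ Set.Ioo d ⊤ \ Q := (Set.subset_insert e E).trans hE
      have hcov : d ⋖ e := ⟨he.1, fun x hdx hxe => heQ (hup hdx hxe he.2)⟩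
      have hei : Moves e i := by
        by_contra hei
        exact heQ ⟨hJ e, he.2, e, hJ e, he.1, le_rfl, hei⟩
      have hUV : Q ∪ insert e E ⊆ Set.Ioo d ⊤ :=
        Set.union_subset hQsub (hE.trans Set.sdiff_subset)
      have hUe : (Q ∪ insert e E) \ {e} = Q ∪ E := by
        ext x
        simp only [Set.mem_sdiff, Set.mem_union, Set.mem_insert_iff, Set.mem_singleton_iff]
        constructor
        · tauto
        · rintro (hx | hx)
          · exact ⟨Or.inl hx, fun hxe => heQ (hxe ▸ hx)⟩
          · exact ⟨Or.inr (Or.inr hx), fun hxe => heE (hxe ▸ hx)⟩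
      have hlink : (Q ∪ insert e E) ∩ Set.Ioi e = Set.Ioo e ⊤ :=
        Set.Subset.antisymm (fun x hx => ⟨hx.2, (hUV hx.1).2⟩)
          fun x hx => ⟨Or.inl (hup he.1 hx.1 hx.2), hx.1⟩
      refine flagCycles_le_of_minimal (e := e)
        (T := {s ∈ S | BlocksSubordinate s e ∧ MovedOnce s i}) hUV (Or.inr (Or.inl rfl))
        (fun x hx hxe => hcov.2 (hUV hx).1 hxe) (fun s hs => ⟨hs.1, hs.2.1.mono he.1.le⟩)
        (by rw [hlink]; exact h e hcov he.2 hei) (fun s hs => hs.2.1.mem_joinsOfAtoms hk)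
        (fun s hs => ?_) (by rw [hUe]; exact ih hE')
      have hdJ : d ∈ joinsOfAtoms s := (hs.2.1.mono he.1.le).mem_joinsOfAtoms hk
      have hroom : ∀ x ∈ joinsOfAtoms s, e < x →
          ∃ z ∈ joinsOfAtoms s, d < z ∧ z ≤ x ∧ ¬ Moves z i := by
        intro x hx hex
        obtain ⟨z, hz, hzx, hzi, hzd⟩ :=
          exists_joinsOfAtoms_not_le hk hs.2.2 he.1.le hex hx hei hs.2.1
        exact ⟨d ⊔ z, sup_mem_joinsOfAtoms hdJ hz, left_lt_sup.2 hzd,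
          sup_le (he.1.le.trans hex.le) hzx,
          le_isolate.1 (sup_le ((le_isolate (hi := hi)).2 hdi) (le_isolate.2 hzi))⟩
      rw [hlink, hUe]
      -- The link cycles in `Π_s` are filled inside `aboveFixing s d i`, which is acyclic, lies in
      -- `Π_s`, and is contained in `Q`, hence avoids `e`.
      have h1 : Set.Ioo e ⊤ ∩ joinsOfAtoms s ⊆ aboveFixing s d i := fun x hx =>
        ⟨hx.2, hx.1.2, hroom x hx.2 hx.1.1⟩
      have h2 : aboveFixing s d i ⊆ (Q ∪ E) ∩ joinsOfAtoms s := by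
        rintro x ⟨hx, hxt, z, -, hz⟩
        exact ⟨Or.inl ⟨hJ x, hxt, z, hJ z, hz⟩, hx⟩
      refine (flagCycles_mono h1 _).trans (le_trans ?_ (flagBoundaries_mono h2 _))
      refine flagCycles_aboveFixing_le hi hitop ?_ _
      obtain ⟨z, hz, hdz, -, hzi⟩ := hroom ⊤ (hS s hs.1) he.2
      exact ⟨z, hz, hdz, hzi⟩
  have := key (Set.Ioo d ⊤ \ Q) le_rfl
  rwa [Set.union_sdiff_cancel hQsub] at this

/-! ### Pairs of one-block partitions with a common point. -/

/-- The sets of two one-block partitions with join `⊤` and intersection `0` whose non-trivial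
blocks have no point other than `j` in common. -/
def pairsMeetingAt (j : Fin n) : Set (Set (PiLattice n k)) :=
  {s | (∃ A B : PiLattice n k, s = {A, B} ∧ IsOneBlock A ∧ IsOneBlock B ∧
    A ⊔ B = ⊤ ∧ subspace A ⊓ subspace B = ⊥) ∧ ∀ i, i ≠ j → MovedOnce s i}

theorem top_mem_joinsOfAtoms_of_pairsMeetingAt (hk : 2 ≤ k) {j : Fin n}
    {s : Set (PiLattice n k)} (hs : s ∈ pairsMeetingAt j) : ⊤ ∈ joinsOfAtoms s := by
  obtain ⟨⟨A, B, rfl, -, -, h, -⟩, -⟩ := hs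
  rw [← h]
  exact sup_mem_joinsOfAtoms (mem_joinsOfAtoms_of_le hk (Or.inl rfl) le_rfl)
    (mem_joinsOfAtoms_of_le hk (Or.inr rfl) le_rfl)

theorem isOneBlock_oneBlock (hk : 2 ≤ k) {S : Set (Fin n)} (hS : k ≤ S.ncard) :
    IsOneBlock (oneBlock S hS) := by
  have hclass : ∀ x ∈ S, {y | (oneBlock S hS).1 y x} = S := fun x hx => by
    ext y
    refine ⟨?_, fun hy => Or.inr ⟨hy, hx⟩⟩
    rintro (rfl | h)
    · exact hx
    · exact h.1
  obtain ⟨x, hx⟩ := Set.nonempty_of_ncard_ne_zero (by omega : S.ncard ≠ 0)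
  refine ⟨S, ⟨⟨x, (hclass x hx).symm⟩, by omega⟩, ?_⟩
  rintro b ⟨⟨y, rfl⟩, hb⟩
  by_cases hy : y ∈ S
  · exact hclass y hy
  · refine absurd (Set.ncard_eq_one.2 ⟨y, Set.ext fun z => ⟨?_, ?_⟩⟩) hb
    · rintro (rfl | h)
      · rfl
      · exact absurd h.2 hy
    · rintro rfl
      exact Or.inl rfl

/-- Only this inclusion is needed for a zero intersection: if two blocks meet in one point, a common
vector is supported there, and its coordinate sum is zero. -/
theorem subspace_oneBlock_le (hk : 2 ≤ k) {S : Set (Fin n)} (hS : k ≤ S.ncard) {x : Fin n → ℂ}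
    (hx : x ∈ subspace (oneBlock S hS)) : ∑ i, x i = 0 ∧ ∀ i ∉ S, x i = 0 := by
  let W : Submodule ℂ (Fin n → ℂ) :=
    { carrier := {x | ∑ i, x i = 0 ∧ ∀ i ∉ S, x i = 0}
      zero_mem' := by simp
      add_mem' := by
        rintro x y ⟨hx, hx'⟩ ⟨hy, hy'⟩
        exact ⟨by simp [Finset.sum_add_distrib, hx, hy], fun j hj => by simp [hx' j hj, hy' j hj]⟩
      smul_mem' := by
        rintro c x ⟨hx, hx'⟩
        exact ⟨by simp [← Finset.mul_sum, hx], fun j hj => by simp [hx' j hj]⟩ }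
  suffices h : subspace (oneBlock S hS) ≤ W from h hx
  refine iSup₂_le fun ω hω => ?_
  obtain ⟨hcard, b, ⟨y, rfl⟩, hsub⟩ := hω
  have hωS : ∀ i ∈ ω, i ∈ S := fun i hi => by
    obtain ⟨i', hi', hne⟩ := Finset.exists_mem_ne (by omega : 1 < ω.card) i
    have h1 : (oneBlock S hS).1 i' y := hsub hi'
    have h2 : (oneBlock S hS).1 i y := hsub hi
    exact mem_of_moves_oneBlock ⟨i', hne, (oneBlock S hS).1.trans h2 ((oneBlock S hS).1.symm h1)⟩
  rintro x ⟨h1, h2⟩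
  refine ⟨?_, fun i hi => h2 i fun h => hi (hωS i h)⟩
  rw [← h1]
  exact (Finset.sum_subset (Finset.subset_univ ω) fun i _ hi => h2 i hi).symm

theorem pair_mem_pairsMeetingAt (hk : 2 ≤ k) {S T : Set (Fin n)} (hS : k ≤ S.ncard)
    (hT : k ≤ T.ncard) {j : Fin n} (hST : S ∩ T = {j}) (hun : S ∪ T = Set.univ) :
    {oneBlock S hS, oneBlock T hT} ∈ pairsMeetingAt j := by
  have hj : j ∈ S ∩ T := hST ▸ rfl
  refine ⟨⟨_, _, rfl, isOneBlock_oneBlock hk hS, isOneBlock_oneBlock hk hT, ?_, ?_⟩, ?_⟩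
  · rw [eq_top_iff, PiLattice.le_iff]
    intro x y _
    have hr : ∀ x, (oneBlock S hS ⊔ oneBlock T hT).1 x j := fun x => by
      rcases (hun ▸ Set.mem_univ x : x ∈ S ∪ T) with h | h
      · exact (le_sup_left : oneBlock S hS ≤ _) (Or.inr ⟨h, hj.1⟩)
      · exact (le_sup_right : oneBlock T hT ≤ _) (Or.inr ⟨h, hj.2⟩)
    exact Setoid.trans' _ (hr x) (Setoid.symm' _ (hr y))
  · rw [eq_bot_iff]
    rintro x ⟨hx1, hx2⟩
    obtain ⟨hsum, h1⟩ := subspace_oneBlock_le hk hS hx1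
    obtain ⟨-, h2⟩ := subspace_oneBlock_le hk hT hx2
    have h3 : ∀ i, i ≠ j → x i = 0 := fun i hi => by
      by_cases hiS : i ∈ S
      · exact h2 i fun hiT => hi (hST.subset ⟨hiS, hiT⟩)
      · exact h1 i hiS
    rw [Finset.sum_eq_single j (fun i _ hi => h3 i hi) (by simp)] at hsum
    refine funext fun i => ?_
    by_cases hi : i = j
    · exact hi ▸ hsum
    · exact h3 i hi
  · have hcon : ∀ i, i ≠ j → Moves (oneBlock S hS) i → Moves (oneBlock T hT) i → False :=
      fun i hi h1 h2 => hi (hST.subset ⟨mem_of_moves_oneBlock h1, mem_of_moves_oneBlock h2⟩)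
    rintro i hi A (rfl | rfl) B (rfl | rfl) hA hB
    · rfl
    · exact (hcon i hi hA hB).elim
    · exact (hcon i hi hB hA).elim
    · rfl

/-- If `d` has no trivial blocks and at least two blocks, a single pair contains everything
above `d`. -/
theorem exists_pair_of_forall_moves (hk : 2 ≤ k) {d : PiLattice n k} (hd : ∀ i, Moves d i)
    {j j' : Fin n} (hj : ¬ d.1 j j') :
    ∃ s ∈ pairsMeetingAt j, BlocksSubordinate s d ∧ ∀ x, d ≤ x → x ∈ joinsOfAtoms s := by
  set T : Set (Fin n) := {y | d.1 j y} with hT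
  set S : Set (Fin n) := insert j Tᶜ with hSdef
  have hjT : j ∈ T := d.1.refl j
  have hcl : ∀ u, u ∉ T → ∀ v, d.1 u v → v ∉ T := fun u hu v huv hv =>
    hu (d.1.trans hv (d.1.symm huv))
  have hTk : k ≤ T.ncard := (hd j).le_ncard
  have hSk : k ≤ S.ncard := (hd j').le_ncard.trans
    (Set.ncard_le_ncard (fun v hv => Or.inr (hcl j' hj v hv)) (Set.toFinite _))
  have hmem := pair_mem_pairsMeetingAt hk hSk hTk (j := j)
    (by ext x
        simp only [hSdef, Set.mem_inter_iff, Set.mem_insert_iff, Set.mem_compl_iff,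
          Set.mem_singleton_iff]
        constructor
        · tauto
        · rintro rfl
          exact ⟨Or.inl rfl, hjT⟩)
    (by ext x
        simp only [hSdef, Set.mem_union, Set.mem_insert_iff, Set.mem_compl_iff, Set.mem_univ,
          iff_true]
        tauto)
  have hsub : BlocksSubordinate {oneBlock S hSk, oneBlock T hTk} d := fun x => by
    by_cases hx : x ∈ T
    · exact ⟨_, Or.inr rfl, fun y hy => Or.inr ⟨hx, d.1.trans hx hy⟩⟩
    · exact ⟨_, Or.inl rfl, fun y hy => Or.inr ⟨Or.inr hx, Or.inr (hcl x hx y hy)⟩⟩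
  refine ⟨_, hmem, hsub, fun x hx => mem_joinsOfAtoms_iff.2 fun D hD => ?_⟩
  have hJle : ∀ z ∈ joinsOfAtoms {oneBlock S hSk, oneBlock T hTk}, z ≤ x → z ≤ D :=
    fun z hz hzx => mem_joinsOfAtoms_iff.1 hz D fun t h1 h2 h3 => hD t h1 h2 (h3.trans hzx)
  have hdD : d ≤ D := hJle d (hsub.mem_joinsOfAtoms hk) hx
  have hout : ∀ u v, u ∉ T → v ∈ S → x.1 u v → D.1 u v := by
    intro u v hu hv huv
    have hc : k ≤ ({w | x.1 u w} ∩ S).ncard := (hd u).le_ncard.trans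
      (Set.ncard_le_ncard (fun w hw => ⟨hx hw, Or.inr (hcl u hu w hw)⟩) (Set.toFinite _))
    have hle := hJle (oneBlock ({w | x.1 u w} ∩ S) hc)
      (mem_joinsOfAtoms_of_le hk (Or.inl rfl) (oneBlock_le.2 fun a ha b hb => Or.inr ⟨ha.2, hb.2⟩))
      (oneBlock_le.2 fun a ha b hb => x.1.trans (x.1.symm ha.1) hb.1)
    exact oneBlock_le.1 hle u ⟨x.1.refl u, Or.inr hu⟩ v ⟨huv, hv⟩
  -- A block of `x` that meets both sides contains all of `T`, hence `j`; as `j` lies in both blocks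
  -- of the pair, `u` is joined to `v` through `j`.
  have hout' : ∀ u v, u ∉ T → x.1 u v → D.1 u v := by
    intro u v hu huv
    by_cases hv : v ∈ T
    · exact D.1.trans (hout u j hu (Or.inl rfl) (x.1.trans huv (x.1.symm (hx hv)))) (hdD hv)
    · exact hout u v hu (Or.inr hv) huv
  refine PiLattice.le_iff.2 fun u v huv => ?_
  by_cases hu : u ∈ T
  · by_cases hv : v ∈ T
    · exact hdD (d.1.trans (d.1.symm hu) hv)
    · exact D.1.symm (hout' v u hv (x.1.symm huv))
  · exact hout' u v hu huv

/-! ### Induction on the number of trivial blocks. -/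

/-- The number of trivial blocks. -/
noncomputable def fixedCard (d : PiLattice n k) : ℕ := {i | ¬ Moves d i}.ncard

open Classical in
/-- A cover of `d` that joins a trivial block `{i}` to a non-trivial block makes no further
identifications. -/
theorem rel_of_covBy {d e : PiLattice n k} (hde : d ⋖ e) {i i' : Fin n} (hi : ¬ Moves d i)
    (hi' : Moves d i') (hii' : e.1 i i') {x y : Fin n} (hxy : e.1 x y) :
    d.1 (if x = i then i' else x) (if y = i then i' else y) := by
  set f : Fin n → Fin n := fun x => if x = i then i' else x with hf
  have hdf : ∀ {x y}, d.1 x y → d.1 (f x) (f y) := by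
    intro x y hxy
    by_cases hx : x = i
    · subst hx
      rw [eq_of_not_moves hi hxy]
    · by_cases hy : y = i
      · subst hy
        exact absurd (eq_of_not_moves hi (d.1.symm hxy)) hx
      · simpa [hf, hx, hy] using hxy
  have hne : i' ≠ i := fun h => hi (h ▸ hi')
  -- Pulling `d` back along `i ↦ i'` attaches `i` to the block of `i'` and changes nothing else.
  -- Since `d < t ≤ e`, the covering relation forces `t = e`.
  let t : PiLattice n k := ⟨Setoid.comap f d.1, blocks_of_le_ncard fun x y hyx hxy => by
    change d.1 (f x) (f y) at hxy
    have hm : Moves d (f x) := by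
      by_cases hfx : f x = f y
      · by_cases hx : x = i
        · simpa [hf, hx] using hi'
        · by_cases hy : y = i
          · rw [hfx]
            simpa [hf, hy] using hi'
          · simp only [hf, hx, hy, if_false] at hfx
            exact absurd hfx.symm hyx
      · exact ⟨f y, fun h => hfx h.symm, hxy⟩
    refine hm.le_ncard.trans (Set.ncard_le_ncard (fun z hz => ?_) (Set.toFinite _))
    have hff : f (f x) = f x := by
      by_cases hx : x = i <;> simp [hf, hx]
    have := hdf hz
    rwa [hff] at this⟩
  have hdt : d ≤ t := PiLattice.le_iff.2 fun x y hxy => hdf hxy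
  have hf1 : ∀ x, e.1 x (f x) := fun x => by
    by_cases hx : x = i
    · subst hx
      simpa [hf] using hii'
    · simp [hf, hx]
  have hte : t ≤ e := PiLattice.le_iff.2 fun x y hxy =>
    e.1.trans (hf1 x) (e.1.trans (hde.le hxy) (e.1.symm (hf1 y)))
  have htd : t ≠ d := fun h => hi (h ▸ ⟨i', hne, by
    change d.1 (f i) (f i')
    simp only [hf, if_true, hne, if_false]
    exact d.1.refl _⟩)
  have : t = e := (hde.eq_or_eq hdt hte).resolve_left htd
  rw [← this] at hxy
  exact hxy

/-- No flag has a negative number of elements. The dimension bound takes effect by driving the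
induction into this vacuous range. -/
theorem flagCycles_eq_bot_of_neg {X : Type*} [PartialOrder X] {U : Set X} {q : ℤ} (hq : q < 0) :
    flagCycles R U q = ⊥ := by
  rw [eq_bot_iff]
  intro z hz
  rw [Submodule.mem_bot, ← Finsupp.support_eq_empty, Finset.eq_empty_iff_forall_notMem]
  intro s hs
  have := (mem_flagChains.1 hz.1 s hs).2
  omega

/-- The cycles above a partition `d` that moves `j` are spanned by those in the subposets of
pairs meeting at `j`, in all dimensions if `d` has at least two non-trivial blocks and in small
dimensions otherwise. -/
theorem flagCycles_Ioo_le_of_moves (hk : 2 ≤ k) (hkn : k ≤ n) {j : Fin n} (d : PiLattice n k)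
    (q : ℤ) (hj : Moves d j)
    (hq : q + 1 < fixedCard d ∨ ∃ j', Moves d j' ∧ ¬ d.1 j j') :
    flagCycles R (Set.Ioo d ⊤) q ≤
      spannedCycles R joinsOfAtoms {s ∈ pairsMeetingAt j | BlocksSubordinate s d}
        (Set.Ioo d ⊤) q := by
  induction hN : fixedCard d using Nat.strong_induction_on generalizing d q with
  | _ N ih =>
  subst hN
  by_cases hall : ∀ i, Moves d i
  · have h0 : fixedCard d = 0 := by simp [fixedCard, hall]
    rcases hq with hq | ⟨j', -, hj'⟩
    · rw [flagCycles_eq_bot_of_neg (by rw [h0] at hq; push_cast at hq; omega)]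
      exact bot_le
    · obtain ⟨s, hs, hsub, hmem⟩ := exists_pair_of_forall_moves hk hall hj'
      have hIoo : Set.Ioo d ⊤ ⊆ Set.Ioo d ⊤ ∩ joinsOfAtoms s := fun x hx => ⟨hx, hmem x hx.1.le⟩
      exact (flagCycles_mono hIoo q).trans (flagCycles_le_spannedCycles _ q ⟨hs, hsub⟩)
  · push Not at hall
    obtain ⟨i, hi⟩ := hall
    have hij : i ≠ j := fun h => hi (h ▸ hj)
    have hicard : k ≤ ({i}ᶜ : Set (Fin n)).ncard := hj.le_ncard.trans
      (Set.ncard_le_ncard (fun y hy hyi => hi (by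
        rw [Set.mem_singleton_iff] at hyi
        subst hyi
        exact ⟨j, hij.symm, d.1.symm hy⟩)) (Set.toFinite _))
    have hitop : Moves (⊤ : PiLattice n k) i := ⟨j, hij.symm, top_rel hkn _ _⟩
    by_cases hda : d = oneBlock {i}ᶜ hicard
    · have hfix : fixedCard d ≤ 1 := by
        rw [fixedCard, ← Set.ncard_singleton i]
        refine Set.ncard_le_ncard (fun x hx => ?_) (Set.toFinite _)
        by_contra hxi
        exact hx (hda ▸ moves_oneBlock hk hxi)
      rcases hq with hq | ⟨j', hj', hjj'⟩
      · rw [flagCycles_eq_bot_of_neg (by omega)]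
        exact bot_le
      · refine absurd ?_ hjj'
        rw [hda]
        exact Or.inr ⟨hij.symm, fun h => hi (Set.mem_singleton_iff.1 h ▸ hj')⟩
    · refine flagCycles_Ioo_le_spannedCycles hk hicard hitop hi hda
        (fun s hs => top_mem_joinsOfAtoms_of_pairsMeetingAt hk hs) q fun e hde _ hei => ?_
      have hsub : {x | ¬ Moves e x} ⊆ {x | ¬ Moves d x} := fun x hx h => hx (h.mono hde.le)
      have hlt : fixedCard e < fixedCard d :=
        Set.ncard_lt_ncard ⟨hsub, fun h => h hi hei⟩ (Set.toFinite _)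
      -- If `e` attaches `i` to a non-trivial block of `d`, only `i` stops being fixed, so either
      -- alternative passes from `d` to `e`. Otherwise the new block of `i` is separate from that of
      -- `j`.
      have hq' : q - 1 + 1 < fixedCard e ∨ ∃ j', Moves e j' ∧ ¬ e.1 j j' := by
        by_cases hcase : ∃ i', Moves d i' ∧ e.1 i i'
        · obtain ⟨i', hi', hii'⟩ := hcase
          have hrel : ∀ x y, x ≠ i → y ≠ i → e.1 x y → d.1 x y := fun x y hx hy hxy => by
            simpa [hx, hy] using rel_of_covBy hde hi hi' hii' hxy
          rcases hq with hq | ⟨j', hj', hjj'⟩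
          · left
            have hle : fixedCard d ≤ fixedCard e + 1 := by
              have h1 : {x | ¬ Moves d x} ⊆ insert i {x | ¬ Moves e x} := by
                intro x hx
                by_contra hcon
                rw [Set.mem_insert_iff, not_or] at hcon
                obtain ⟨hxi, hcon⟩ := hcon
                obtain ⟨y, hyx, hxy⟩ : Moves e x := not_not.1 hcon
                by_cases hyi : y = i
                · subst hyi
                  have := rel_of_covBy hde hi hi' hii' hxy
                  simp only [hxi, if_false, if_true] at this
                  have h2 := eq_of_not_moves hx this
                  exact hx (h2 ▸ hi')
                · exact hx ⟨y, hyx, hrel x y hxi hyi hxy⟩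
              exact (Set.ncard_le_ncard h1 (Set.toFinite _)).trans (Set.ncard_insert_le _ _)
            omega
          · exact Or.inr ⟨j', hj'.mono hde.le,
              fun h => hjj' (hrel j j' hij.symm (fun h => hi (h ▸ hj')) h)⟩
        · exact Or.inr ⟨i, hei, fun h => hcase ⟨j, hj, e.1.symm h⟩⟩
      refine (ih _ hlt e (q - 1) (hj.mono hde.le) hq' rfl).trans
        (spannedCycles_mono (fun s hs => ?_) _ _)
      exact ⟨hs.1, hs.2, hs.1.2 i hij⟩

/-- In small dimensions the cycles of the proper part of `Π` are spanned by those in the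
subposets of pairs. -/
theorem flagCycles_Ioo_bot_le (hk : 2 ≤ k) (hkn : k ≤ n) {q : ℤ} (hq : q < (n : ℤ) - k) :
    flagCycles R (Set.Ioo (⊥ : PiLattice n k) ⊤) q ≤
      spannedCycles R joinsOfAtoms {s | ∃ j, s ∈ pairsMeetingAt j} (Set.Ioo ⊥ ⊤) q := by
  rcases hkn.eq_or_lt with rfl | hlt
  · rw [flagCycles_eq_bot_of_neg (by omega)]
    exact bot_le
  have : NeZero n := ⟨by omega⟩
  set i : Fin n := 0
  have hicard : k ≤ ({i}ᶜ : Set (Fin n)).ncard := by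
    rw [Set.ncard_compl, Set.ncard_singleton, Nat.card_eq_fintype_card, Fintype.card_fin]
    omega
  have hitop : Moves (⊤ : PiLattice n k) i :=
    ⟨⟨1, by omega⟩, by simp [i, Fin.ext_iff], top_rel hkn _ _⟩
  refine (flagCycles_Ioo_le_spannedCycles (S := {s | ∃ j, s ∈ pairsMeetingAt j}) hk hicard hitop
    (not_moves_bot i) (oneBlock_ne_bot hk hicard).symm
    (fun s ⟨j, hs⟩ => top_mem_joinsOfAtoms_of_pairsMeetingAt hk hs) q ?_).trans
    (spannedCycles_mono (fun s hs => hs.1) _ _)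
  intro e he _ hei
  have hek := hei.le_ncard
  -- Choosing the meeting point `j` different from `i` ensures that pairs meeting at `j` move `i`
  -- only once.
  obtain ⟨j, hji, hij⟩ := hei
  have hatom : IsAtom e := bot_covBy_iff.1 he
  -- The atom `e` is the one-block partition of any `k`-subset of its block, so it has at least `n -
  -- k` fixed points.
  obtain ⟨T, hT, hTk⟩ := Set.exists_subset_card_eq hek
  have heT : e = oneBlock T hTk.ge := ((hatom.le_iff.1 (oneBlock_le.2 fun u hu v hv =>
    e.1.trans (e.1.symm (hT hu)) (hT hv))).resolve_left (oneBlock_ne_bot hk _)).symm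
  have hfix : n - k ≤ fixedCard e := by
    have h1 : Tᶜ ⊆ {x | ¬ Moves e x} := fun x hx h => hx (mem_of_moves_oneBlock (heT ▸ h))
    have h2 := Set.ncard_le_ncard h1 (Set.toFinite _)
    rw [Set.ncard_compl, hTk, Nat.card_eq_fintype_card, Fintype.card_fin] at h2
    exact h2
  refine (flagCycles_Ioo_le_of_moves hk hkn (j := j) e (q - 1) ⟨i, hji.symm, e.1.symm hij⟩
    (Or.inl (by omega))).trans (spannedCycles_mono (fun s hs => ?_) _ _)
  exact ⟨⟨j, hs.1⟩, hs.2, hs.1.2 i hji.symm⟩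

end KEqual

/-! ### Transfer to reduced homology. -/

namespace PosetHomology

variable {P Q : Type*} [PartialOrder P] [PartialOrder Q] {R : Type*} [CommRing R]

theorem FinFlag.map_injective (f : P ↪o Q) : Function.Injective (FinFlag.map f) := fun _ _ h =>
  Subtype.ext (Finset.map_injective f.toEmbedding (congrArg Subtype.val h))

theorem chainMap_injective (f : P ↪o Q) : Function.Injective (chainMap R f) :=
  Finsupp.mapDomain_injective (FinFlag.map_injective f)

theorem map_chains (f : P ↪o Q) (p : ℤ) :
    (chains R P p).map (chainMap R f) = flagChains R (Set.range f) (p + 1) := by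
  classical
  rw [chains, chainMap, Finsupp.lmapDomain_supported, flagChains]
  congr 1
  ext t
  constructor
  · rintro ⟨s, hs, rfl⟩
    refine ⟨fun x hx => ?_, ?_⟩
    · obtain ⟨a, -, rfl⟩ := Finset.mem_map.1 hx
      exact ⟨a, rfl⟩
    · exact (congrArg Nat.cast (Finset.card_map _)).trans hs
  · rintro ⟨ht, hcard⟩
    obtain ⟨u, hu⟩ : ∃ u : Finset P, u.map f.toEmbedding = t.1 := by
      refine ⟨t.1.preimage f f.injective.injOn, ?_⟩
      rw [Finset.map_eq_image]
      exact Finset.image_preimage_of_bij (fun x => f x) t.1 ⟨fun _ h => h, f.injective.injOn,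
        fun x hx => by
          obtain ⟨a, rfl⟩ := ht x hx
          exact ⟨a, hx, rfl⟩⟩
    refine ⟨⟨u, fun a ha b hb _ => ?_⟩, ?_, Subtype.ext hu⟩
    · have hmem : ∀ {c}, c ∈ u → f c ∈ t.1 := fun hc =>
        hu ▸ Finset.mem_map_of_mem f.toEmbedding hc
      exact (t.2.total (hmem ha) (hmem hb)).imp f.le_iff_le.1 f.le_iff_le.1
    · change (u.card : ℤ) = p + 1
      rw [← hcard, ← hu, Finset.card_map]

theorem map_cycles (f : P ↪o Q) (p : ℤ) :
    (cycles R P p).map (chainMap R f) = flagCycles R (Set.range f) (p + 1) := by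
  ext z
  constructor
  · rintro ⟨w, hw, rfl⟩
    refine ⟨(map_chains (R := R) f p).le ⟨w, hw.1, rfl⟩, ?_⟩
    change boundary R Q _ = 0
    rw [← chainMap_boundary, LinearMap.mem_ker.1 hw.2, map_zero]
  · rintro ⟨hz, hz'⟩
    rw [← map_chains] at hz
    obtain ⟨w, hw, rfl⟩ := hz
    refine ⟨w, ⟨hw, chainMap_injective (R := R) f ?_⟩, rfl⟩
    rw [chainMap_boundary, map_zero]
    exact hz'

theorem map_boundaries (f : P ↪o Q) (p : ℤ) :
    (boundaries R P p).map (chainMap R f) = flagBoundaries R (Set.range f) (p + 1) := by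
  rw [flagBoundaries, ← map_chains, boundaries, ← Submodule.map_comp, ← Submodule.map_comp]
  congr 1
  exact LinearMap.ext fun x => chainMap_boundary R f x

theorem boundaries_le_cycles (P : Type*) [PartialOrder P] (p : ℤ) :
    boundaries R P p ≤ cycles R P p := by
  rintro _ ⟨w, hw, rfl⟩
  refine ⟨?_, boundary_boundary w⟩
  have h1 : w ∈ flagChains R (Set.univ : Set P) (p + 1 + 1) :=
    mem_flagChains.2 fun s hs => ⟨fun _ _ => trivial, hw hs⟩
  intro s hs
  have := (mem_flagChains.1 (boundary_mem_flagChains h1) s hs).2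
  rw [add_sub_cancel_right] at this
  exact this

set_option maxSynthPendingDepth 10 in
/-- The homology class of a cycle. -/
noncomputable def homologyClass (R : Type*) [CommRing R] (P : Type*) [PartialOrder P] (p : ℤ) :
    cycles R P p →ₗ[R] RedHomology R P p :=
  Submodule.mkQ ((boundaries R P p).submoduleOf (cycles R P p))

set_option maxSynthPendingDepth 10 in
theorem homologyClass_surjective (p : ℤ) : Function.Surjective (homologyClass R P p) :=
  Submodule.mkQ_surjective _

set_option maxSynthPendingDepth 10 in
theorem homologyClass_eq_zero {p : ℤ} {z : cycles R P p} (hz : z.1 ∈ boundaries R P p) :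
    homologyClass R P p z = 0 :=
  (Submodule.Quotient.mk_eq_zero _).2 hz

theorem redHomologyMap_homologyClass (f : P ↪o Q) {p : ℤ} (z : cycles R P p) :
    redHomologyMap R f p (homologyClass R P p z) = homologyClass R Q p (cyclesMap R f p z) := rfl

end PosetHomology

namespace KEqual

open PosetHomology

variable {n k : ℕ} {R : Type*} [CommRing R]

theorem range_subtype_properPart :
    Set.range (OrderEmbedding.subtype fun C : PiLattice n k => C ≠ ⊥ ∧ C ≠ ⊤) = Set.Ioo ⊥ ⊤ := by
  ext x
  constructor
  · rintro ⟨y, rfl⟩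
    exact ⟨bot_lt_iff_ne_bot.2 y.2.1, lt_top_iff_ne_top.2 y.2.2⟩
  · exact fun h => ⟨⟨x, h.1.ne', h.2.ne⟩, rfl⟩

theorem range_subtype_pairPoset (s : Set (PiLattice n k)) :
    Set.range ((OrderEmbedding.subtype (· ∈ pairPoset s)).trans
      (OrderEmbedding.subtype fun C : PiLattice n k => C ≠ ⊥ ∧ C ≠ ⊤)) =
      Set.Ioo ⊥ ⊤ ∩ joinsOfAtoms s := by
  ext x
  constructor
  · rintro ⟨y, rfl⟩
    exact ⟨⟨bot_lt_iff_ne_bot.2 y.1.2.1, lt_top_iff_ne_top.2 y.1.2.2⟩, y.2⟩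
  · exact fun h => ⟨⟨⟨x, h.1.1.ne', h.1.2.ne⟩, h.2⟩, rfl⟩

theorem chainMap_trans {P Q T : Type*} [PartialOrder P] [PartialOrder Q] [PartialOrder T]
    (f : P ↪o Q) (g : Q ↪o T) :
    chainMap R (f.trans g) = chainMap R g ∘ₗ chainMap R f := by
  rw [chainMap, chainMap, chainMap, ← Finsupp.lmapDomain_comp]
  congr 1
  exact funext fun s => Subtype.ext (Finset.map_map _ _ _).symm

/-- The induced map into the flag chains of the full lattice is injective, so the inclusion may be
tested there, where every poset involved is a subset; the shift `q = p + 1` turns the bound into `q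
< n - k`. -/
theorem cycles_properPart_le (hk : 2 ≤ k) (hkn : k ≤ n) {p : ℤ} (hp : p < (n : ℤ) - k - 1) :
    cycles R (ProperPart n k) p ≤ boundaries R (ProperPart n k) p ⊔
      ⨆ s : Pairs n k, (cycles R (pairPoset s.1) p).map
        (chainMap R (OrderEmbedding.subtype (· ∈ pairPoset s.1))) := by
  set f := OrderEmbedding.subtype fun C : PiLattice n k => C ≠ ⊥ ∧ C ≠ ⊤ with hf
  have hinj : Function.Injective (chainMap R f) := chainMap_injective f
  rw [← Submodule.map_le_map_iff_of_injective hinj, map_cycles, range_subtype_properPart,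
    Submodule.map_sup, map_boundaries, range_subtype_properPart, Submodule.map_iSup]
  refine (flagCycles_Ioo_bot_le hk hkn (by omega)).trans
    (sup_le_sup_left (iSup₂_le fun s hs => ?_) _)
  obtain ⟨j, hs, -⟩ := hs
  refine le_trans (le_of_eq ?_) (le_iSup _ (⟨s, hs⟩ : Pairs n k))
  rw [← Submodule.map_comp, ← chainMap_trans, map_cycles, range_subtype_pairPoset]

end KEqual

theorem lemma8p1 (R : Type*) [CommRing R] (n k : ℕ) (hk : 2 ≤ k) (hkn : k ≤ n) (p : ℤ)
    (hp : p < (n : ℤ) - (k : ℤ) - 1) :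
    Function.Surjective (KEqual.xi R n k p) := by
  classical
  open PosetHomology KEqual in
  intro c
  obtain ⟨z, rfl⟩ := homologyClass_surjective p c
  -- The cycles whose class lies in the range are viewed as a submodule of all chains, so that the
  -- generators of the cycle module can be checked one kind at a time.
  suffices h : cycles R (ProperPart n k) p ≤ ((LinearMap.range (xi R n k p)).comap
      (homologyClass R _ p)).map (cycles R (ProperPart n k) p).subtype by
    obtain ⟨w, hw, hwz⟩ := h z.2
    obtain rfl : w = z := Subtype.ext hwz
    exact hw
  refine (cycles_properPart_le hk hkn hp).trans (sup_le (fun b hb => ?_) (iSup_le fun s => ?_))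
  · refine ⟨⟨b, boundaries_le_cycles _ p hb⟩, ?_, rfl⟩
    change homologyClass R (ProperPart n k) p _ ∈ LinearMap.range _
    rw [homologyClass_eq_zero hb]
    exact Submodule.zero_mem _
  · rintro _ ⟨w, hw, rfl⟩
    refine ⟨cyclesMap R (OrderEmbedding.subtype (· ∈ pairPoset s.1)) p ⟨w, hw⟩, ?_, rfl⟩
    refine ⟨DirectSum.lof R (Pairs n k) (fun s => RedHomology R (pairPoset s.1) p) s
      (homologyClass R _ p ⟨w, hw⟩), ?_⟩
    rw [xi, DirectSum.toModule_lof, redHomologyMap_homologyClass]
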